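/- All graphs are finite, simple and undirected. For a graph $G$ let $m$ be its number of edges, $T_G$ its number of triangles and $\alpha_G$ its arboricity (the least number of forests into which the edges can be partitioned). The $k$-truss of $G$ is the maximal edge-induced subgraph of $G$ in which every edge lies in at least $k$ triangles of the subgraph, and the trussness $t_G$ is the largest $k$ for which the $k$-truss has an edge. Algorithms are deterministic word-RAM programs with words of $O(\log n)$ bits; a graph on $n$ vertices is given by its adjacency matrix. Combinatorial algorithms are treated through black-box reductions. A *black-box algorithm over* a graph algorithm $A$ for Boolean matrix multiplication (BMM) is a word-RAM program $R$ that may call $A$ on graphs described by adjacency expressions of constant size over its input and memory, that uses only the answers of $A$, and that spends only $O(n^2\operatorname{polylog} n)$ time on $n\times n$ matrices, i.e. time nearly linear in the input, outside the calls; its total time also counts the running time of all calls, including the evaluation of the adjacency expressions. (So $R$ does nothing by itself except nearly-linear bookkeeping, and it gives a combinatorial algorithm whenever $A$ is combinatorial, for every notion of "combinatorial" that is closed under such reductions.) **Theorem.** Let $c\ge 1$ and $\kappa>0$ be constants. There is one program $R$, depending only on $c$ and $\kappa$, with the following property. Let $A$ be any algorithm that, on every nonempty graph $G$ without isolated vertices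 with $T_G\ge\kappa m$, returns a rational number $\tilde t$ that approximates $t_G$ within the multiplicative factor $c$ (that is, $t_G/c\le\tilde t\le c\,t_G$) or within the additive term $c^2/2$ (that is, $|\tilde t-t_G|\le c^2/2$), and whose worst-case running time is polynomially smaller than $m\,\alpha_G$ up to the time for reading the input and up to logarithmic factors, i.e. at most $O\big((n^2+(m\,\alpha_G)^{1-\varepsilon})\operatorname{polylog} n\big)$ for some constant $\varepsilon>0$. Then $R$, as a black-box algorithm over $A$, multiplies $n\times n$ Boolean matrices in total time $O(n^{3-\delta})$ for some constant $\delta>0$. In other words: even for graphs with $\Omega(m)$ triangles, no combinatorial algorithm approximates $t_G$ within a factor $c$ or an additive term $c^2/2$ in time $\tilde o(m\,\alpha_G)$, unless BMM has a truly subcubic combinatorial algorithm. -/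

import Mathlib

/-! ### Graph parameters -/

/-- The number of triangles of `H` through the pair `u, v` (for an edge `uv`, its support in `H`). -/
noncomputable def edgeSupport {V : Type*} (H : SimpleGraph V) (u v : V) : ℕ :=
  (H.neighborSet u ∩ H.neighborSet v).ncard

/-- `H` is the `k`-truss of `G`: a maximal subgraph of `G` in which every edge lies in at least `k`
triangles of the subgraph. Edge-induced subgraphs are identified with their edge sets, that is, with
graphs `H ≤ G` on the same vertices. -/
def IsKTruss {V : Type*} (G : SimpleGraph V) (k : ℕ) (H : SimpleGraph V) : Prop :=
  Maximal (fun H' : SimpleGraph V => H' ≤ G ∧ ∀ u v, H'.Adj u v → k ≤ edgeSupport H' u v) H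

/-- The trussness `t_G`: the largest `k` for which `G` has a `k`-truss with at least one edge
(`0` for a graph without edges). -/
noncomputable def trussness {V : Type*} (G : SimpleGraph V) : ℕ :=
  sSup {k : ℕ | ∃ H : SimpleGraph V, IsKTruss G k H ∧ H ≠ ⊥}

/-- The arboricity `α_G`: the least number of forests into which the edges of `G` can be
partitioned. -/
noncomputable def arboricity {V : Type*} (G : SimpleGraph V) : ℕ :=
  sInf {k : ℕ | ∃ F : Fin k → SimpleGraph V,
    (∀ i, (F i).IsAcyclic) ∧ (∀ i j, i ≠ j → Disjoint (F i) (F j)) ∧ (⨆ i, F i) = G}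

/-- The number `m` of edges. -/
noncomputable def edgeCount {V : Type*} (G : SimpleGraph V) : ℕ := G.edgeSet.ncard

/-- The number `T_G` of triangles. -/
noncomputable def triangleCount {V : Type*} (G : SimpleGraph V) : ℕ := (G.cliqueSet 3).ncard

/-- `x` approximates `t` within the factor `c`, or within the additive term `c ^ 2 / 2`. -/
def ApproxWithin (c t x : ℝ) : Prop :=
  (t / c ≤ x ∧ x ≤ c * t) ∨ |x - t| ≤ c ^ 2 / 2

/-! ### A word RAM with a step count

Programs have finitely many registers, an addressable memory, and a read-only input that is accessed
by probes. All words have `k * (⌊log₂ n⌋ + 1)` bits, where `n` is the size parameter of the input and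
`k` is a constant of the program. -/

/-- Word operations. -/
inductive RamOp
  | add | sub | mul | div | mod | band | bor | bxor | shl | shr | lt | eq

def RamOp.apply : RamOp → ℕ → ℕ → ℕ
  | .add, a, b => a + b
  | .sub, a, b => a - b
  | .mul, a, b => a * b
  | .div, a, b => a / b
  | .mod, a, b => a % b
  | .band, a, b => a &&& b
  | .bor, a, b => a ||| b
  | .bxor, a, b => a ^^^ b
  | .shl, a, b => a <<< b
  | .shr, a, b => a >>> b
  | .lt, a, b => if a < b then 1 else 0
  | .eq, a, b => if a = b then 1 else 0

/-- Expressions: literals, registers, memory cells, probes `inp b i j` of entry `(i, j)` of the `b`-th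
input matrix, word operations, and conditional expressions. -/
inductive RamExpr
  | lit (k : ℕ)
  | reg (r : ℕ)
  | mem (a : RamExpr)
  | inp (b i j : RamExpr)
  | bin (o : RamOp) (e f : RamExpr)
  | cond (e f g : RamExpr)

/-- The number of elementary operations needed to evaluate an expression. -/
def RamExpr.size : RamExpr → ℕ
  | .lit _ => 1
  | .reg _ => 1
  | .mem a => a.size + 1
  | .inp b i j => b.size + i.size + j.size + 1
  | .bin _ e f => e.size + f.size + 1
  | .cond e f g => e.size + f.size + g.size + 1

/-- Contents of the registers and of the memory. -/
structure RamState where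
  reg : ℕ → ℕ
  mem : ℕ → ℕ

/-- The value of an expression in a state; `W` is two to the word length, and results of operations
are reduced modulo `W`. -/
def RamExpr.eval (W : ℕ) (input : ℕ → ℕ → ℕ → ℕ) (s : RamState) : RamExpr → ℕ
  | .lit k => k % W
  | .reg r => s.reg r
  | .mem a => s.mem (a.eval W input s)
  | .inp b i j => input (b.eval W input s) (i.eval W input s) (j.eval W input s) % W
  | .bin o e f => o.apply (e.eval W input s) (f.eval W input s) % W
  | .cond e f g => if e.eval W input s ≠ 0 then f.eval W input s else g.eval W input s

/-- Commands. `query p q N acc` calls an external graph algorithm on the graph with `N` vertices whose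
adjacency matrix is given by the expression `acc`: the entry `(u, v)` is the value of `acc` when
registers `0` and `1` hold `u` and `v` and everything else is as in the current state. The two words
that the algorithm returns go to the registers `p` and `q`. -/
inductive RamCmd
  | skip
  | assign (r : ℕ) (e : RamExpr)
  | store (a e : RamExpr)
  | seq (x y : RamCmd)
  | branch (e : RamExpr) (x y : RamCmd)
  | loop (e : RamExpr) (x : RamCmd)
  | query (p q : ℕ) (N acc : RamExpr)

/-- The adjacency matrix that the accessor `acc` of a query describes. -/
def queryMatrix (W : ℕ) (input : ℕ → ℕ → ℕ → ℕ) (s : RamState) (acc : RamExpr) (u v : ℕ) : ℕ :=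
  acc.eval W input { s with reg := Function.update (Function.update s.reg 0 u) 1 v }

/-- Big-step semantics. `RamExec W input ext x s s' t t'` says that the command `x`, started in state
`s`, halts in state `s'` after `t` steps of its own and after spending time `t'` inside its calls.
`ext N adj a b τ` says that the external algorithm, run on the `N × N` adjacency matrix `adj`, halts
after `τ` steps and returns `a, b`. Such a call costs `(acc.size + 1) * τ`, since each of the at most
`τ` probes that the external algorithm makes is answered by an evaluation of `acc`. -/
inductive RamExec (W : ℕ) (input : ℕ → ℕ → ℕ → ℕ)
    (ext : ℕ → (ℕ → ℕ → ℕ) → ℕ → ℕ → ℕ → Prop) :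
    RamCmd → RamState → RamState → ℕ → ℕ → Prop
  | skip (s : RamState) : RamExec W input ext .skip s s 1 0
  | assign (r : ℕ) (e : RamExpr) (s : RamState) :
      RamExec W input ext (.assign r e) s
        { s with reg := Function.update s.reg r (e.eval W input s) } (e.size + 1) 0
  | store (a e : RamExpr) (s : RamState) :
      RamExec W input ext (.store a e) s
        { s with mem := Function.update s.mem (a.eval W input s) (e.eval W input s) }
        (a.size + e.size + 1) 0
  | seq {x y : RamCmd} {s₁ s₂ s₃ : RamState} {t₁ t₂ t₁' t₂' : ℕ}
      (h₁ : RamExec W input ext x s₁ s₂ t₁ t₁') (h₂ : RamExec W input ext y s₂ s₃ t₂ t₂') :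
      RamExec W input ext (.seq x y) s₁ s₃ (t₁ + t₂) (t₁' + t₂')
  | branch_then {e : RamExpr} {x y : RamCmd} {s₁ s₂ : RamState} {t t' : ℕ}
      (he : e.eval W input s₁ ≠ 0) (h : RamExec W input ext x s₁ s₂ t t') :
      RamExec W input ext (.branch e x y) s₁ s₂ (e.size + 1 + t) t'
  | branch_else {e : RamExpr} {x y : RamCmd} {s₁ s₂ : RamState} {t t' : ℕ}
      (he : e.eval W input s₁ = 0) (h : RamExec W input ext y s₁ s₂ t t') :
      RamExec W input ext (.branch e x y) s₁ s₂ (e.size + 1 + t) t'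
  | loop_done {e : RamExpr} {x : RamCmd} {s : RamState} (he : e.eval W input s = 0) :
      RamExec W input ext (.loop e x) s s (e.size + 1) 0
  | loop_step {e : RamExpr} {x : RamCmd} {s₁ s₂ s₃ : RamState} {t₁ t₂ t₁' t₂' : ℕ}
      (he : e.eval W input s₁ ≠ 0) (h₁ : RamExec W input ext x s₁ s₂ t₁ t₁')
      (h₂ : RamExec W input ext (.loop e x) s₂ s₃ t₂ t₂') :
      RamExec W input ext (.loop e x) s₁ s₃ (e.size + 1 + t₁ + t₂) (t₁' + t₂')
  | query {p q : ℕ} {N acc : RamExpr} {s : RamState} {a b τ : ℕ}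
      (h : ext (N.eval W input s) (queryMatrix W input s acc) a b τ) :
      RamExec W input ext (.query p q N acc) s
        { s with reg := Function.update (Function.update s.reg p (a % W)) q (b % W) }
        (N.size + 1) ((acc.size + 1) * τ)

/-- Two to the word length `k * (⌊log₂ n⌋ + 1)`. -/
def wordModulus (k n : ℕ) : ℕ := 2 ^ (k * (Nat.log 2 n + 1))

/-- Initially register `0` holds the size parameter, and all else is zero. -/
def RamState.init (n : ℕ) : RamState where
  reg := fun r => if r = 0 then n else 0
  mem := fun _ => 0

/-- A stand-alone algorithm: a command with the constant that fixes its word length. -/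
structure RamProgram where
  code : RamCmd
  wordConst : ℕ

/-- Run without external algorithm (so `query` never succeeds) on the `n × n` matrix `adj`, the program
`A` halts after `t` steps and returns `a` and `b` in its registers `0` and `1`. -/
def RamProgram.Runs (A : RamProgram) (n : ℕ) (adj : ℕ → ℕ → ℕ) (a b t : ℕ) : Prop :=
  ∃ s : RamState,
    RamExec (wordModulus A.wordConst n) (fun _ => adj) (fun _ _ _ _ _ => False)
      A.code (RamState.init n) s t 0 ∧ s.reg 0 = a ∧ s.reg 1 = b

open Classical in
/-- The adjacency matrix of a graph on `Fin n`, extended by zero. -/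
noncomputable def adjacencyInput {n : ℕ} (G : SimpleGraph (Fin n)) (i j : ℕ) : ℕ :=
  if ∃ (hi : i < n) (hj : j < n), G.Adj ⟨i, hi⟩ ⟨j, hj⟩ then 1 else 0

open Classical in
/-- Two Boolean matrices as input: the matrix number `0` is `X`, every other one is `Y`. -/
noncomputable def matrixInput {n : ℕ} (X Y : Matrix (Fin n) (Fin n) Bool) (b i j : ℕ) : ℕ :=
  if ∃ (hi : i < n) (hj : j < n), (if b = 0 then X else Y) ⟨i, hi⟩ ⟨j, hj⟩ = true then 1 else 0

/-! ### The two problems -/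

/-- On every nonempty graph without isolated vertices that has at least `κ m` triangles, `A` returns a
fraction that approximates the trussness within the factor `c` or the additive term `c ^ 2 / 2`, and
its worst-case running time is polynomially smaller than `m α`, up to the time for reading the
adjacency matrix and up to logarithmic factors: `O((n ^ 2 + (m α) ^ (1 - ε)) polylog n)` for some
`ε > 0`. -/
def FastTrussnessApprox (c κ : ℝ) (A : RamProgram) : Prop :=
  ∃ ε : ℝ, 0 < ε ∧ ∃ (C : ℝ) (k : ℕ), ∀ n : ℕ, 1 ≤ n → ∀ G : SimpleGraph (Fin n),
    (∀ v, ∃ w, G.Adj v w) → κ * edgeCount G ≤ triangleCount G →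
    ∃ a b t : ℕ, A.Runs n (adjacencyInput G) a b t ∧ 0 < b ∧
      ApproxWithin c (trussness G) ((a : ℝ) / b) ∧
      (t : ℝ) ≤ C * ((n : ℝ) ^ 2 + ((edgeCount G : ℝ) * arboricity G) ^ (1 - ε))
        * (1 + Real.log n) ^ k

/-- With `A` as its external graph algorithm, the command `R` computes Boolean products of `n × n`
matrices (entry `(i, j)` of the product ends up in memory cell `i * n + j`) in truly subcubic total
time `O(n ^ (3 - δ))`, of which only `O(n ^ 2 polylog n)` is spent outside the calls of `A`. -/
def TrulySubcubicBMM (R : RamCmd) (A : RamProgram) : Prop :=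
  ∃ (w : ℕ) (δ : ℝ), 0 < δ ∧ ∃ (C : ℝ) (k : ℕ), ∀ n : ℕ, 1 ≤ n →
    ∀ X Y : Matrix (Fin n) (Fin n) Bool, ∃ (s : RamState) (t t' : ℕ),
      RamExec (wordModulus w n) (matrixInput X Y) A.Runs R (RamState.init n) s t t' ∧
      (∀ i j : Fin n, s.mem ((i : ℕ) * n + (j : ℕ)) = if ∃ l, X i l = true ∧ Y l j = true then 1 else 0) ∧
      (t : ℝ) ≤ C * (n : ℝ) ^ 2 * (1 + Real.log n) ^ k ∧
      (t : ℝ) + t' ≤ C * (n : ℝ) ^ (3 - δ)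

/-! ### General facts on the graph parameters -/

/-! Two reductions are composed: Boolean matrix multiplication reduces to triangle detection in
small graphs, and triangle detection reduces to a rough approximation of the trussness.

Matrix multiplication. Cut the indices into blocks of length σ = ⌊n^(1/3)⌋. A triple of blocks (I,
J, K) gives a tripartite graph on 3σ vertices: I–J edges are the ones of the first matrix, J–K edges
the ones of the second, and I–K edges the pairs not yet recorded as ones of the product. Its
triangles are the witnesses of new ones of the product (`exists_triangle_blockRel`). If there is a
triangle, a binary search over the numbered I–K pairs isolates a new pair, which is recorded, and
the same triple is treated again; otherwise the next triple follows. Each round uses up a triple or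
fills one of n² cells. There are at most 64 n² triples (`IsRoot.blocks_le`), so O(n²) rounds with
O(log n) detections each suffice; σ is chosen to balance the two counts. The graphs are never
written down: a fixed expression answers adjacency probes, which keeps the own time at O(n² log n).

Detection. Blow up each vertex of the tripartite graph F to L copies. A triangle of F becomes a
subgraph in which every edge lies in at least L triangles (`le_trussness_gadget`); without triangles
the blow-up has none either. A disjoint background of three vertex groups supplies P² h triangles,
hence at least κ m, but every edge between its first group and the other two lies in at most h
triangles. A subgraph with all supports above h loses these edges and then every other background
triangle edge (`trussness_gadget_le`). The background is also matched to the blow-up, so that no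
vertex is isolated. With constants h ≪ θ ≪ L, comparing the answer with θ decides whether F has a
triangle (`approx_iff`).

Time. A query graph has N = O(σ) vertices, so N² = O(n^(2/3)) and mα ≤ N³ = O(n). A call thus costs
n^(1-ε') polylog n, and O(n² log n) calls stay truly subcubic. -/

theorem arboricity_le (n : ℕ) (G : SimpleGraph (Fin n)) : arboricity G ≤ n := by
  -- Each edge goes to the class of its smaller endpoint; every class is a subgraph of a star, so
  -- `n` forests suffice.
  refine Nat.sInf_le ⟨fun i =>
    { Adj := fun x y => G.Adj x y ∧ min x y = i
      symm := ⟨fun x y h => ⟨h.1.symm, by rw [min_comm]; exact h.2⟩⟩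
      loopless := ⟨fun x h => G.loopless.irrefl x h.1⟩ }, ?_, ?_, ?_⟩
  · intro i
    refine (SimpleGraph.isAcyclic_starGraph i).anti fun x y h => ?_
    rw [SimpleGraph.starGraph_adj]
    refine ⟨h.1.ne, ?_⟩
    rcases min_choice x y with h3 | h3
    · exact Or.inl (h3.symm.trans h.2)
    · exact Or.inr (h3.symm.trans h.2)
  · intro i j hij
    rw [disjoint_iff_inf_le]
    intro x y h
    exact absurd (h.1.2.symm.trans h.2.2) hij
  · ext x y
    simp [SimpleGraph.iSup_adj]

theorem edgeCount_le (n : ℕ) (G : SimpleGraph (Fin n)) : edgeCount G ≤ n * n := by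
  classical
  unfold edgeCount
  have h1 : G.edgeSet.ncard = G.edgeFinset.card := by
    rw [← SimpleGraph.coe_edgeFinset, Set.ncard_coe_finset]
  rw [h1]
  refine G.card_edgeFinset_le_card_choose_two.trans ?_
  rw [Fintype.card_fin, Nat.choose_two_right]
  exact (Nat.div_le_self _ _).trans (Nat.mul_le_mul le_rfl (Nat.sub_le _ _))

theorem edgeSupport_le_card {n : ℕ} (H : SimpleGraph (Fin n)) (u v : Fin n) :
    edgeSupport H u v ≤ n := by
  unfold edgeSupport
  refine (Set.ncard_le_card _).trans ?_
  simp

theorem edgeSupport_mono {n : ℕ} {G H : SimpleGraph (Fin n)} (h : H ≤ G) (u v : Fin n) :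
    edgeSupport H u v ≤ edgeSupport G u v :=
  Set.ncard_le_ncard (fun _ hx => ⟨h hx.1, h hx.2⟩) (Set.toFinite _)

/-- There are finitely many subgraphs, so any witness extends to a maximal one. Supports are at most
`n`, which gives the boundedness that `sSup` on `ℕ` needs to be meaningful. -/
theorem le_trussness {n : ℕ} {G H : SimpleGraph (Fin n)} {k : ℕ} (hHG : H ≤ G) (hH : H ≠ ⊥)
    (hk : ∀ u v, H.Adj u v → k ≤ edgeSupport H u v) : k ≤ trussness G := by
  refine le_csSup ⟨n, ?_⟩ ?_
  · rintro k ⟨H, hH, hne⟩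
    obtain ⟨u, v, huv⟩ := SimpleGraph.ne_bot_iff_exists_adj.mp hne
    exact (hH.prop.2 u v huv).trans (edgeSupport_le_card H u v)
  · obtain ⟨M, hM, hmax⟩ := (Set.toFinite
      {H' : SimpleGraph (Fin n) | H' ≤ G ∧ ∀ u v, H'.Adj u v → k ≤ edgeSupport H' u v}).exists_le_maximal
      (show H ∈ _ from ⟨hHG, hk⟩)
    exact ⟨M, hmax, fun h => hH (le_bot_iff.mp (h ▸ hM))⟩

theorem trussness_le {n : ℕ} {G : SimpleGraph (Fin n)} {t : ℕ}
    (h : ∀ H ≤ G, (∀ u v, H.Adj u v → t < edgeSupport H u v) → H = ⊥) : trussness G ≤ t := by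
  refine csSup_le' ?_
  rintro k ⟨H, hH, hne⟩
  by_contra! hk
  exact hne (h H hH.prop.1 fun u v huv => hk.trans_le (hH.prop.2 u v huv))

theorem ncard_le_of_val_mem_Ico {n : ℕ} (s : Set (Fin n)) (a h : ℕ)
    (hs : ∀ x ∈ s, a ≤ (x : ℕ) ∧ (x : ℕ) < a + h) : s.ncard ≤ h := by
  have := Set.ncard_le_ncard_of_injOn (t := (Finset.Ico a (a + h) : Set ℕ)) (fun x : Fin n => (x : ℕ))
    (fun x hx => by simpa using hs x hx) Fin.val_injective.injOn (Finset.finite_toSet _)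
  rwa [Set.ncard_coe_finset, Nat.card_Ico, Nat.add_sub_cancel_left] at this

/-! ### The gadget graph -/

/-- Four groups of vertices: `[0, P)` carries the `L`-fold blow-up of `F`, `[P, 2P)` is matched with it
and completely joined to the rest, and `[2P, 3P)` and `[3P, 4P + h)` induce a band of width `h`. -/
def gadgetRel (F : ℕ → ℕ → Prop) (P L h u v : ℕ) : Prop :=
  (u < P ∧ v < P ∧ F (u / L) (v / L)) ∨ (u < P ∧ v = u + P) ∨
    (P ≤ u ∧ u < 2 * P ∧ 2 * P ≤ v) ∨ (2 * P ≤ u ∧ u < 3 * P ∧ u + P ≤ v ∧ v < u + P + h)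

def gadget (F : ℕ → ℕ → Prop) (P L h : ℕ) : SimpleGraph (Fin (4 * P + h)) :=
  SimpleGraph.fromRel fun u v => gadgetRel F P L h u v

section gadget

variable {F : ℕ → ℕ → Prop} {P L h : ℕ}

theorem gadget_adj (u v : Fin (4 * P + h)) : (gadget F P L h).Adj u v ↔
    (u : ℕ) ≠ v ∧ (gadgetRel F P L h u v ∨ gadgetRel F P L h v u) := by
  simp [gadget, SimpleGraph.fromRel_adj, Fin.ext_iff]

theorem gadget_exists_adj (hP : 0 < P) (v : Fin (4 * P + h)) : ∃ w, (gadget F P L h).Adj v w := by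
  simp only [gadget_adj]
  by_cases h1 : (v : ℕ) < P
  · exact ⟨⟨v + P, by omega⟩, by simp; omega, Or.inl (Or.inr (Or.inl ⟨h1, rfl⟩))⟩
  by_cases h2 : (v : ℕ) < 2 * P
  · exact ⟨⟨2 * P, by omega⟩, by simp; omega,
      Or.inl (Or.inr (Or.inr (Or.inl ⟨by omega, h2, le_rfl⟩)))⟩
  · exact ⟨⟨P, by omega⟩, by simp; omega,
      Or.inr (Or.inr (Or.inr (Or.inl ⟨le_rfl, by simp; omega, by omega⟩)))⟩

/-- Every band edge forms a triangle with each of the `P` vertices of the second group. The three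
vertices lie in disjoint ranges, so the triangle determines its parameters. -/
theorem le_triangleCount_gadget : P * (P * h) ≤ triangleCount (gadget F P L h) := by
  unfold triangleCount
  have hcard : (Set.univ : Set (Fin P × Fin P × Fin h)).ncard = P * (P * h) := by
    simp [Set.ncard_univ]
  rw [← hcard]
  refine Set.ncard_le_ncard_of_injOn (fun x => ({⟨P + x.1, by omega⟩, ⟨2 * P + x.2.1, by omega⟩,
    ⟨3 * P + x.2.1 + x.2.2, by omega⟩} : Finset (Fin (4 * P + h)))) ?_ ?_ (Set.toFinite _)
  · rintro ⟨w, a, y⟩ -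
    simp only [SimpleGraph.mem_cliqueSet_iff, SimpleGraph.is3Clique_triple_iff, gadget_adj]
    refine ⟨⟨by omega, ?_⟩, ⟨by omega, ?_⟩, by omega, ?_⟩ <;> left <;> unfold gadgetRel <;> omega
  · rintro ⟨w, a, y⟩ - ⟨w', a', y'⟩ - heq
    simp only at heq
    have m1 : (⟨P + w, by omega⟩ : Fin (4 * P + h)) ∈ ({⟨P + w', by omega⟩, ⟨2 * P + a', by omega⟩,
        ⟨3 * P + a' + y', by omega⟩} : Finset (Fin (4 * P + h))) := by rw [← heq]; simp
    have m2 : (⟨2 * P + a, by omega⟩ : Fin (4 * P + h)) ∈ ({⟨P + w', by omega⟩, ⟨2 * P + a', by omega⟩,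
        ⟨3 * P + a' + y', by omega⟩} : Finset (Fin (4 * P + h))) := by rw [← heq]; simp
    have m3 : (⟨3 * P + a + y, by omega⟩ : Fin (4 * P + h)) ∈ ({⟨P + w', by omega⟩,
        ⟨2 * P + a', by omega⟩, ⟨3 * P + a' + y', by omega⟩} : Finset (Fin (4 * P + h))) := by
      rw [← heq]; simp
    simp only [Finset.mem_insert, Finset.mem_singleton, Fin.mk.injEq] at m1 m2 m3
    have e1 : (w : ℕ) = w' := by omega
    have e2 : (a : ℕ) = a' := by omega
    have e3 : (y : ℕ) = y' := by omega
    simp [Fin.ext_iff, e1, e2, e3]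

/-- The second group is independent and sees the blow-up only through the matching, so the common
neighbours of `u` and `v` are the band neighbours of `v`, which form an interval of length at most
`h`. -/
theorem edgeSupport_gadget_le {u v : Fin (4 * P + h)} (hu : P ≤ (u : ℕ)) (hu' : (u : ℕ) < 2 * P)
    (hv : 2 * P ≤ (v : ℕ)) : edgeSupport (gadget F P L h) u v ≤ h := by
  unfold edgeSupport
  by_cases h3 : (v : ℕ) < 3 * P
  · refine ncard_le_of_val_mem_Ico _ (v + P) h ?_
    rintro z ⟨h1, h2⟩
    simp only [SimpleGraph.mem_neighborSet, gadget_adj, gadgetRel] at h1 h2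
    omega
  -- On the far side of the band the neighbours `z` satisfy `v - P - h < z ≤ v - P`, hence the shift
  -- by one.
  · refine ncard_le_of_val_mem_Ico _ (v + 1 - P - h) h ?_
    rintro z ⟨h1, h2⟩
    simp only [SimpleGraph.mem_neighborSet, gadget_adj, gadgetRel] at h1 h2
    omega

theorem trussness_gadget_le (hF : ∀ a b, F a b → a < b)
    (hfree : ¬ ∃ a b c, F a b ∧ F b c ∧ F a c) : trussness (gadget F P L h) ≤ h := by
  refine trussness_le fun H hHG hH => ?_
  -- Edges between the second group and the band have too little support to survive in `H`.
  have hcross : ∀ u v : Fin (4 * P + h), P ≤ (u : ℕ) → (u : ℕ) < 2 * P → 2 * P ≤ (v : ℕ) →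
      ¬ H.Adj u v := by
    intro u v h1 h2 h3 h4
    have := (hH u v h4).trans_le ((edgeSupport_mono hHG u v).trans (edgeSupport_gadget_le h1 h2 h3))
    exact lt_irrefl _ this
  -- Without those edges, matching edges and the bipartite band lie in no triangle of `H`, whereas a
  -- surviving edge has positive support. Only the blow-up remains.
  have hB : ∀ u v : Fin (4 * P + h), H.Adj u v → gadgetRel F P L h u v →
      (u : ℕ) < P ∧ (v : ℕ) < P ∧ F (u / L) (v / L) := by
    intro u v huv hr
    have hne : (H.neighborSet u ∩ H.neighborSet v).Nonempty := by
      rw [← Set.ncard_pos (Set.toFinite _)]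
      exact (Nat.zero_le h).trans_lt (hH u v huv)
    obtain ⟨z, hz1, hz2⟩ := hne
    have hz1' := hHG hz1
    have hz2' := hHG hz2
    have c1 := hcross u v
    have c2 := hcross z u
    have c3 := hcross z v
    have hz1s := H.symm.symm _ _ hz1
    have hz2s := H.symm.symm _ _ hz2
    simp only [SimpleGraph.mem_neighborSet] at hz1 hz2
    rw [gadget_adj] at hz1' hz2'
    simp only [huv, hz1s, hz2s, not_true, imp_false] at c1 c2 c3
    rcases hr with hr | hr
    · exact hr
    · exfalso
      unfold gadgetRel at *
      omega
  have hB' : ∀ u v : Fin (4 * P + h), H.Adj u v →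
      F (u / L) (v / L) ∨ F (v / L) (u / L) := by
    intro u v huv
    rcases ((gadget_adj u v).mp (hHG huv)).2 with hr | hr
    · exact Or.inl (hB u v huv hr).2.2
    · exact Or.inr (hB v u huv.symm hr).2.2
  by_contra hne
  obtain ⟨u, v, huv⟩ := SimpleGraph.ne_bot_iff_exists_adj.mp hne
  have hne : (H.neighborSet u ∩ H.neighborSet v).Nonempty := by
    rw [← Set.ncard_pos (Set.toFinite _)]
    exact (Nat.zero_le h).trans_lt (hH u v huv)
  obtain ⟨z, hz1, hz2⟩ := hne
  have k1 := hB' u v huv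
  have k2 := hB' u z hz1
  have k3 := hB' v z hz2
  generalize (u : ℕ) / L = a at *
  generalize (v : ℕ) / L = b at *
  generalize (z : ℕ) / L = d at *
  -- Of the eight orientations of the projected triangle, the two cyclic ones contradict `a < b`
  -- along `F`; the other six are triangles of `F`.
  rcases k1 with k1 | k1 <;> rcases k2 with k2 | k2 <;> rcases k3 with k3 | k3
  · exact hfree ⟨_, _, _, k1, k3, k2⟩
  · exact hfree ⟨_, _, _, k2, k3, k1⟩
  · have := hF _ _ k1; have := hF _ _ k2; have := hF _ _ k3; omega
  · exact hfree ⟨_, _, _, k2, k1, k3⟩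
  · exact hfree ⟨_, _, _, k1, k2, k3⟩
  · have := hF _ _ k1; have := hF _ _ k2; have := hF _ _ k3; omega
  · exact hfree ⟨_, _, _, k3, k2, k1⟩
  · exact hfree ⟨_, _, _, k3, k1, k2⟩

theorem le_trussness_gadget (hF : ∀ a b, F a b → a < b) (hL : 0 < L)
    {a b c : ℕ} (hc : (c + 1) * L ≤ P) (hab : F a b) (hbc : F b c) (hac : F a c) :
    L ≤ trussness (gadget F P L h) := by
  have hlt1 := hF _ _ hab
  have hlt2 := hF _ _ hbc
  let f : ℕ → ℕ → Prop := fun i j => (i = a ∧ j = b) ∨ (i = b ∧ j = c) ∨ (i = a ∧ j = c)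
  have hin : ∀ x y, f x y → F x y := by
    rintro x y (⟨rfl, rfl⟩ | ⟨rfl, rfl⟩ | ⟨rfl, rfl⟩) <;> assumption
  have hrange : ∀ x : ℕ, x / L ≤ c → x < P := by
    intro x hx
    have := Nat.lt_mul_of_div_lt (Nat.lt_succ_of_le hx) hL
    exact this.trans_le hc
  let H : SimpleGraph (Fin (4 * P + h)) :=
    { Adj := fun x y => f (x / L) (y / L) ∨ f (y / L) (x / L)
      symm := ⟨fun x y hxy => hxy.symm⟩
      loopless := ⟨fun x hx => by
        have : f (x / L) (x / L) := hx.elim id id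
        have := hF _ _ (hin _ _ this)
        omega⟩ }
  have hmul : ∀ i k, k < L → (i * L + k) / L = i := by
    intro i k hk
    rw [mul_comm, Nat.mul_add_div hL, Nat.div_eq_of_lt hk, add_zero]
  have hlt : ∀ i k, i ≤ c → k < L → i * L + k < P := by
    intro i k hi hk
    apply hrange
    rw [hmul i k hk]
    exact hi
  refine le_trussness (H := H) ?_ ?_ ?_
  · intro x y hxy
    rw [gadget_adj]
    have hx : (x : ℕ) < P := by
      apply hrange
      rcases hxy with hxy | hxy <;> simp only [f] at hxy <;> omega
    have hy : (y : ℕ) < P := by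
      apply hrange
      rcases hxy with hxy | hxy <;> simp only [f] at hxy <;> omega
    refine ⟨?_, hxy.imp (fun hf => Or.inl ⟨hx, hy, hin _ _ hf⟩)
      (fun hf => Or.inl ⟨hy, hx, hin _ _ hf⟩)⟩
    intro hne
    rw [← Fin.ext_iff] at hne
    subst hne
    exact H.loopless.irrefl _ hxy
  · rw [SimpleGraph.ne_bot_iff_exists_adj]
    refine ⟨⟨a * L + 0, ?_⟩, ⟨b * L + 0, ?_⟩, Or.inl (Or.inl ?_)⟩
    · have := hlt a 0 (by omega) hL; omega
    · have := hlt b 0 (by omega) hL; omega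
    · simp only [hmul _ 0 hL, and_self]
  -- The common neighbours of two vertices from different classes include the entire third class,
  -- which has `L` elements.
  · have hclass : ∀ (u v : Fin (4 * P + h)) (i : ℕ), i ≤ c →
        (f (u / L) i ∨ f i (u / L)) → (f (v / L) i ∨ f i (v / L)) → L ≤ edgeSupport H u v := by
      intro u v i hi hu hv
      unfold edgeSupport
      have hcard : (Set.univ : Set (Fin L)).ncard = L := by simp [Set.ncard_univ]
      conv_lhs => rw [← hcard]
      refine Set.ncard_le_ncard_of_injOn
        (fun k => ⟨i * L + k, by have := hlt i k hi k.2; omega⟩) ?_ ?_ (Set.toFinite _)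
      · intro k _
        simp only [Set.mem_inter_iff, SimpleGraph.mem_neighborSet, H, hmul i k k.2]
        exact ⟨hu, hv⟩
      · intro k _ k' _ hk
        simp only [Fin.mk.injEq] at hk
        ext
        omega
    intro u v huv
    have : f (u / L) (v / L) ∨ f (v / L) (u / L) := huv
    simp only [f] at this
    rcases this with (⟨h1, h2⟩ | ⟨h1, h2⟩ | ⟨h1, h2⟩) | (⟨h1, h2⟩ | ⟨h1, h2⟩ | ⟨h1, h2⟩)
    · refine hclass u v c le_rfl ?_ ?_ <;> simp [f, h1, h2]
    · refine hclass u v a (by omega) ?_ ?_ <;> simp [f, h1, h2]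
    · refine hclass u v b (by omega) ?_ ?_ <;> simp [f, h1, h2]
    · refine hclass u v c le_rfl ?_ ?_ <;> simp [f, h1, h2]
    · refine hclass u v a (by omega) ?_ ?_ <;> simp [f, h1, h2]
    · refine hclass u v b (by omega) ?_ ?_ <;> simp [f, h1, h2]

end gadget

/-! ### Reasoning about word-RAM programs -/

section ram

variable {W : ℕ} {input : ℕ → ℕ → ℕ → ℕ} {ext : ℕ → (ℕ → ℕ → ℕ) → ℕ → ℕ → ℕ → Prop}

theorem RamExpr.eval_le {B : ℕ} {s : RamState} (hW : 0 < W) (hB : W ≤ B)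
    (hr : ∀ r, s.reg r ≤ B) (hm : ∀ a, s.mem a ≤ B) (e : RamExpr) : e.eval W input s ≤ B := by
  cases e with
  | reg r => exact hr r
  | mem a => exact hm _
  | lit k => exact (Nat.mod_lt _ hW).le.trans hB
  | inp b i j => exact (Nat.mod_lt _ hW).le.trans hB
  | bin o e f => exact (Nat.mod_lt _ hW).le.trans hB
  | cond e f g =>
    rw [RamExpr.eval]
    split_ifs
    · exact RamExpr.eval_le hW hB hr hm f
    · exact RamExpr.eval_le hW hB hr hm g

/-- Without external calls, registers and memory never exceed a bound on the initial state and on the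
word modulus. -/
theorem RamExec.bounded {B : ℕ} (hW : 0 < W) (hB : W ≤ B) {x : RamCmd} {s s' : RamState} {t t' : ℕ}
    (h : RamExec W input (fun _ _ _ _ _ => False) x s s' t t')
    (hs : (∀ r, s.reg r ≤ B) ∧ ∀ a, s.mem a ≤ B) : (∀ r, s'.reg r ≤ B) ∧ ∀ a, s'.mem a ≤ B := by
  induction h with
  | skip s => exact hs
  | assign r e s =>
    refine ⟨fun r' => ?_, hs.2⟩
    by_cases hr : r' = r
    · subst hr
      simpa using RamExpr.eval_le hW hB hs.1 hs.2 e
    · simpa [Function.update_of_ne hr] using hs.1 r'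
  | store a e s =>
    refine ⟨hs.1, fun a' => ?_⟩
    by_cases ha : a' = a.eval W input s
    · subst ha
      simpa using RamExpr.eval_le hW hB hs.1 hs.2 e
    · simpa [Function.update_of_ne ha] using hs.2 a'
  | seq _ _ ih₁ ih₂ => exact ih₂ (ih₁ hs)
  | branch_then _ _ ih => exact ih hs
  | branch_else _ _ ih => exact ih hs
  | loop_done _ => exact hs
  | loop_step _ _ _ ih₁ ih₂ => exact ih₂ (ih₁ hs)
  | query h => exact h.elim

theorem wordModulus_pos (k n : ℕ) : 0 < wordModulus k n := Nat.two_pow_pos _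

/-- `query` truncates answers to the caller's word length; this bound is what shows that nothing is
lost. The summand `n` accounts for register `0`, whose initial value need not be below the modulus.
-/
theorem RamProgram.Runs.le {A : RamProgram} {n : ℕ} {adj : ℕ → ℕ → ℕ} {a b t : ℕ}
    (h : A.Runs n adj a b t) :
    a ≤ n + wordModulus A.wordConst n ∧ b ≤ n + wordModulus A.wordConst n := by
  obtain ⟨s, hs, rfl, rfl⟩ := h
  have := hs.bounded (wordModulus_pos _ _) (Nat.le_add_left _ n)
    ⟨fun r => by simp only [RamState.init]; split_ifs <;> omega, fun a => Nat.zero_le _⟩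
  exact ⟨this.1 0, this.1 1⟩

/-! ### Derived expressions and their values in the absence of overflow -/

namespace RamExpr

def and (e f : RamExpr) : RamExpr := cond e f (lit 0)

def or (e f : RamExpr) : RamExpr := cond e (lit 1) f

def not (e : RamExpr) : RamExpr := cond e (lit 0) (lit 1)

def add (e f : RamExpr) : RamExpr := bin .add e f

def sub (e f : RamExpr) : RamExpr := bin .sub e f

def mul (e f : RamExpr) : RamExpr := bin .mul e f

def div (e f : RamExpr) : RamExpr := bin .div e f

def mod (e f : RamExpr) : RamExpr := bin .mod e f

def lt (e f : RamExpr) : RamExpr := bin .lt e f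

def le (e f : RamExpr) : RamExpr := (f.lt e).not

def eq (e f : RamExpr) : RamExpr := bin .eq e f

variable {s : RamState} {e f : RamExpr} {x y : ℕ} {p q : Prop}

theorem eval_lit_of_lt (h : x < W) : (lit x).eval W input s = x := Nat.mod_eq_of_lt h

theorem eval_add (he : e.eval W input s = x) (hf : f.eval W input s = y) (h : x + y < W) :
    (e.add f).eval W input s = x + y := by
  simp [add, eval, RamOp.apply, he, hf, Nat.mod_eq_of_lt h]

theorem eval_mul (he : e.eval W input s = x) (hf : f.eval W input s = y) (h : x * y < W) :
    (e.mul f).eval W input s = x * y := by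
  simp [mul, eval, RamOp.apply, he, hf, Nat.mod_eq_of_lt h]

theorem eval_sub (he : e.eval W input s = x) (hf : f.eval W input s = y) (h : x < W) :
    (e.sub f).eval W input s = x - y := by
  simp [sub, eval, RamOp.apply, he, hf, Nat.mod_eq_of_lt ((Nat.sub_le x y).trans_lt h)]

theorem eval_div (he : e.eval W input s = x) (hf : f.eval W input s = y) (h : x < W) :
    (e.div f).eval W input s = x / y := by
  simp [div, eval, RamOp.apply, he, hf, Nat.mod_eq_of_lt ((Nat.div_le_self x y).trans_lt h)]

theorem eval_mod (he : e.eval W input s = x) (hf : f.eval W input s = y) (h : x < W) :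
    (e.mod f).eval W input s = x % y := by
  simp [mod, eval, RamOp.apply, he, hf, Nat.mod_eq_of_lt ((Nat.mod_le x y).trans_lt h)]

theorem eval_lt (hW : 1 < W) (he : e.eval W input s = x) (hf : f.eval W input s = y) :
    (e.lt f).eval W input s ≠ 0 ↔ x < y := by
  simp only [lt, eval, RamOp.apply, he, hf]
  split_ifs with h <;> simp [h, Nat.mod_eq_of_lt hW]

theorem eval_eq (hW : 1 < W) (he : e.eval W input s = x) (hf : f.eval W input s = y) :
    (e.eq f).eval W input s ≠ 0 ↔ x = y := by
  simp only [eq, eval, RamOp.apply, he, hf]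
  split_ifs with h <;> simp [h, Nat.mod_eq_of_lt hW]

theorem eval_not (hW : 1 < W) (he : e.eval W input s ≠ 0 ↔ p) :
    e.not.eval W input s ≠ 0 ↔ ¬ p := by
  rw [← he]
  simp only [not, eval]
  split_ifs with h <;> simp [h, Nat.mod_eq_of_lt hW]

theorem eval_le_iff (hW : 1 < W) (he : e.eval W input s = x) (hf : f.eval W input s = y) :
    (e.le f).eval W input s ≠ 0 ↔ x ≤ y :=
  (eval_not hW (eval_lt hW hf he)).trans not_lt

/-- The conjunction is lazy, so the second expression needs the intended value only under `p`. Range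
tests placed first thereby rule out overflow in what follows them. -/
theorem eval_and (he : e.eval W input s ≠ 0 ↔ p) (hf : p → (f.eval W input s ≠ 0 ↔ q)) :
    (e.and f).eval W input s ≠ 0 ↔ p ∧ q := by
  by_cases hp : p
  · simp only [and, eval, he, hp, if_true, true_and, hf hp]
  · simp [and, eval, he, hp]

theorem eval_or (hW : 1 < W) (he : e.eval W input s ≠ 0 ↔ p) (hf : f.eval W input s ≠ 0 ↔ q) :
    (e.or f).eval W input s ≠ 0 ↔ p ∨ q := by
  by_cases hp : p
  · simp [or, eval, he, hp, Nat.mod_eq_of_lt hW]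
  · simp only [or, eval, he, hp, if_false, false_or, hf]

end RamExpr

/-- `x`, started in `s`, halts in a state with `Q` after at most `T` own steps and at most `T'` steps in
calls. -/
def Reaches (W : ℕ) (input : ℕ → ℕ → ℕ → ℕ) (ext : ℕ → (ℕ → ℕ → ℕ) → ℕ → ℕ → ℕ → Prop)
    (x : RamCmd) (s : RamState) (Q : RamState → Prop) (T T' : ℕ) : Prop :=
  ∃ (s' : RamState) (t t' : ℕ), RamExec W input ext x s s' t t' ∧ Q s' ∧ t ≤ T ∧ t' ≤ T'

/-! ### Hoare-style rules with time bounds -/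

namespace Reaches

variable {x y : RamCmd} {s : RamState} {Q Q' : RamState → Prop} {T T' T₁ T₁' T₂ T₂' : ℕ}
  {e : RamExpr}

theorem mono (h : Reaches W input ext x s Q T₁ T₁') (hQ : ∀ s', Q s' → Q' s') (hT : T₁ ≤ T)
    (hT' : T₁' ≤ T') : Reaches W input ext x s Q' T T' := by
  obtain ⟨s', t, t', h1, h2, h3, h4⟩ := h
  exact ⟨s', t, t', h1, hQ _ h2, h3.trans hT, h4.trans hT'⟩

theorem assign {r v : ℕ} (hv : e.eval W input s = v)
    (h : Q { s with reg := Function.update s.reg r v }) :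
    Reaches W input ext (.assign r e) s Q (e.size + 1) 0 :=
  ⟨_, _, _, .assign r e s, hv ▸ h, le_rfl, le_rfl⟩

theorem store {a : RamExpr} {u v : ℕ} (hu : a.eval W input s = u) (hv : e.eval W input s = v)
    (h : Q { s with mem := Function.update s.mem u v }) :
    Reaches W input ext (.store a e) s Q (a.size + e.size + 1) 0 :=
  ⟨_, _, _, .store a e s, hu ▸ hv ▸ h, le_rfl, le_rfl⟩

theorem seq (h : Reaches W input ext x s (fun s' => Reaches W input ext y s' Q T₂ T₂') T₁ T₁') :
    Reaches W input ext (.seq x y) s Q (T₁ + T₂) (T₁' + T₂') := by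
  obtain ⟨s₁, t, t', h1, ⟨s₂, u, u', h2, h3, h4, h5⟩, h6, h7⟩ := h
  exact ⟨s₂, _, _, .seq h1 h2, h3, by omega, by omega⟩

theorem branch (h1 : e.eval W input s ≠ 0 → Reaches W input ext x s Q T T')
    (h2 : e.eval W input s = 0 → Reaches W input ext y s Q T T') :
    Reaches W input ext (.branch e x y) s Q (e.size + 1 + T) T' := by
  by_cases he : e.eval W input s = 0
  · obtain ⟨s', t, t', h, hQ, hT, hT'⟩ := h2 he
    exact ⟨s', _, _, .branch_else he h, hQ, by omega, hT'⟩
  · obtain ⟨s', t, t', h, hQ, hT, hT'⟩ := h1 he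
    exact ⟨s', _, _, .branch_then he h, hQ, by omega, hT'⟩

/-- The potential `μ` drops in every round, so there are at most `m` rounds; the last summand pays
for the failing test. -/
theorem loop (Inv : RamState → Prop) (μ : RamState → ℕ)
    (hstep : ∀ s, Inv s → e.eval W input s ≠ 0 →
      Reaches W input ext x s (fun s' => Inv s' ∧ μ s' < μ s) T T') :
    ∀ (m : ℕ) (s : RamState), Inv s → μ s ≤ m →
      Reaches W input ext (.loop e x) s (fun s' => Inv s' ∧ e.eval W input s' = 0)
        (m * (e.size + 1 + T) + (e.size + 1)) (m * T') := by
  intro m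
  induction m with
  | zero =>
    intro s hs hm
    by_cases he : e.eval W input s = 0
    · exact ⟨s, _, _, .loop_done he, ⟨hs, he⟩, by omega, by omega⟩
    · obtain ⟨s', t, t', h, hQ, hT, hT'⟩ := hstep s hs he
      omega
  | succ m ih =>
    intro s hs hm
    by_cases he : e.eval W input s = 0
    · exact ⟨s, _, _, .loop_done he, ⟨hs, he⟩, by omega, by omega⟩
    · obtain ⟨s', t, t', h, hQ, hT, hT'⟩ := hstep s hs he
      obtain ⟨s'', u, u', h', hQ', hU, hU'⟩ := ih s' hQ.1 (by omega)
      refine ⟨s'', _, _, .loop_step he h h', hQ', ?_, ?_⟩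
      · rw [Nat.succ_mul]; omega
      · rw [Nat.succ_mul]; omega

end Reaches

end ram

/-! ### Triangles in a triple of blocks -/

/-- The edges of the tripartite graph on three blocks of length `σ` with offsets `iB`, `jB`, `kB`. The
pair of the `a`-th element of the first block and the `c`-th element of the third one is numbered
`a * σ + c`; it is an edge if its number is in `[lo, hi)` and its memory cell is still zero. -/
def blockRel (inp : ℕ → ℕ → ℕ → ℕ) (mem : ℕ → ℕ) (n σ lo hi iB jB kB a b : ℕ) : Prop :=
  (a < σ ∧ σ ≤ b ∧ b < 2 * σ ∧ inp 0 (iB + a) (jB + (b - σ)) ≠ 0) ∨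
    (σ ≤ a ∧ a < 2 * σ ∧ 2 * σ ≤ b ∧ b < 3 * σ ∧ inp 1 (jB + (a - σ)) (kB + (b - 2 * σ)) ≠ 0) ∨
    (a < σ ∧ 2 * σ ≤ b ∧ b < 3 * σ ∧ lo ≤ a * σ + (b - 2 * σ) ∧ a * σ + (b - 2 * σ) < hi ∧
      mem ((iB + a) * n + (kB + (b - 2 * σ))) = 0)

/-- The pair number `p` is the end of a path through the second block and is not yet recorded in the
memory. -/
def NewPair (inp : ℕ → ℕ → ℕ → ℕ) (mem : ℕ → ℕ) (n σ iB jB kB p : ℕ) : Prop :=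
  p < σ * σ ∧ mem ((iB + p / σ) * n + (kB + p % σ)) = 0 ∧
    ∃ j < σ, inp 0 (iB + p / σ) (jB + j) ≠ 0 ∧ inp 1 (jB + j) (kB + p % σ) ≠ 0

theorem blockRel_lt {inp : ℕ → ℕ → ℕ → ℕ} {mem : ℕ → ℕ} {n σ lo hi iB jB kB a b : ℕ}
    (h : blockRel inp mem n σ lo hi iB jB kB a b) : a < b ∧ b < 3 * σ := by
  unfold blockRel at h
  omega

/-- A triangle must use one vertex from each block, and the number `a * σ + (c - 2 * σ)` of its
outer pair is decoded by division by `σ` with remainder. -/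
theorem exists_triangle_blockRel {inp : ℕ → ℕ → ℕ → ℕ} {mem : ℕ → ℕ} {n σ lo hi iB jB kB : ℕ} :
    (∃ a b c, blockRel inp mem n σ lo hi iB jB kB a b ∧ blockRel inp mem n σ lo hi iB jB kB b c ∧
      blockRel inp mem n σ lo hi iB jB kB a c) ↔
    ∃ p, lo ≤ p ∧ p < hi ∧ NewPair inp mem n σ iB jB kB p := by
  constructor
  · rintro ⟨a, b, c, hab, hbc, hac⟩
    rcases hab with hab | hab | hab <;> rcases hbc with hbc | hbc | hbc <;>
      rcases hac with hac | hac | hac <;> first | (exfalso; omega) | skip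
    obtain ⟨h1, h2, h3, h4⟩ := hab
    obtain ⟨h5, h6, h7, h8, h9⟩ := hbc
    obtain ⟨h10, h11, h12, h13, h14, h15⟩ := hac
    have hσ : 0 < σ := by omega
    have hd : (a * σ + (c - 2 * σ)) / σ = a := by
      rw [mul_comm, Nat.mul_add_div hσ, Nat.div_eq_of_lt (by omega), add_zero]
    have hm : (a * σ + (c - 2 * σ)) % σ = c - 2 * σ := by
      rw [mul_comm, Nat.mul_add_mod, Nat.mod_eq_of_lt (by omega)]
    refine ⟨a * σ + (c - 2 * σ), h13, h14, ?_, ?_, b - σ, by omega, ?_, ?_⟩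
    · calc a * σ + (c - 2 * σ) < a * σ + σ := by omega
        _ = (a + 1) * σ := by ring
        _ ≤ σ * σ := Nat.mul_le_mul_right _ h10
    · rwa [hd, hm]
    · rwa [hd]
    · rwa [hm]
  · rintro ⟨p, hlo, hhi, hp, hmem, j, hj, h0, h1⟩
    have hσ : 0 < σ := by omega
    have hd : p / σ < σ := Nat.div_lt_of_lt_mul hp
    have hm : p % σ < σ := Nat.mod_lt _ hσ
    have hdm : p / σ * σ + p % σ = p := by rw [mul_comm]; exact Nat.div_add_mod p σ
    have e1 : σ + j - σ = j := by omega
    have e2 : 2 * σ + p % σ - 2 * σ = p % σ := by omega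
    refine ⟨p / σ, σ + j, 2 * σ + p % σ, Or.inl ?_, Or.inr (Or.inl ?_), Or.inr (Or.inr ?_)⟩
    · rw [e1]
      exact ⟨hd, by omega, by omega, h0⟩
    · rw [e1, e2]
      exact ⟨by omega, by omega, by omega, by omega, h1⟩
    · rw [e2, hdm]
      exact ⟨hd, by omega, by omega, hlo, hhi, hmem⟩

/-! ### The program

Registers: `2` the size `n`, `3` the block length `σ`, `4` the number of blocks, `5` the index of the
current triple of blocks, `6` and `7` the range of pairs for a query, `8` the upper end of the search
interval, `9` and `10` the answer of a query, `11` to `13` the offsets of the blocks, and `14` the size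
of a vertex group of the gadget. -/

section program

open RamExpr

def blockExpr (a b : RamExpr) : RamExpr :=
  ((a.lt (reg 3)).and (((reg 3).le b).and ((b.lt ((lit 2).mul (reg 3))).and
      (inp (lit 0) ((reg 11).add a) ((reg 12).add (b.sub (reg 3))))))).or
    ((((reg 3).le a).and ((a.lt ((lit 2).mul (reg 3))).and ((((lit 2).mul (reg 3)).le b).and
        ((b.lt ((lit 3).mul (reg 3))).and
          (inp (lit 1) ((reg 12).add (a.sub (reg 3))) ((reg 13).add (b.sub ((lit 2).mul (reg 3))))))))).or
      ((a.lt (reg 3)).and ((((lit 2).mul (reg 3)).le b).and ((b.lt ((lit 3).mul (reg 3))).and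
        (((reg 6).le ((a.mul (reg 3)).add (b.sub ((lit 2).mul (reg 3))))).and
          ((((a.mul (reg 3)).add (b.sub ((lit 2).mul (reg 3)))).lt (reg 7)).and
            ((mem ((((reg 11).add a).mul (reg 2)).add
              ((reg 13).add (b.sub ((lit 2).mul (reg 3)))))).eq (lit 0))))))))

def gadgetExpr (L h : ℕ) (u v : RamExpr) : RamExpr :=
  ((u.lt (reg 14)).and ((v.lt (reg 14)).and (blockExpr (u.div (lit L)) (v.div (lit L))))).or
    (((u.lt (reg 14)).and (v.eq (u.add (reg 14)))).or
      ((((reg 14).le u).and ((u.lt ((lit 2).mul (reg 14))).and (((lit 2).mul (reg 14)).le v))).or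
        ((((lit 2).mul (reg 14)).le u).and ((u.lt ((lit 3).mul (reg 14))).and
          (((u.add (reg 14)).le v).and (v.lt ((u.add (reg 14)).add (lit h))))))))

def orderExpr (h : ℕ) : RamExpr := ((lit 4).mul (reg 14)).add (lit h)

/-- The range test makes the matrix vanish outside the vertex set, as `adjacencyInput` does, and
coming first it protects the later arithmetic, since probes may carry arbitrary numbers. -/
def accessor (L h : ℕ) : RamExpr :=
  cond (((reg 0).lt (orderExpr h)).and (((reg 1).lt (orderExpr h)).and
    (((reg 0).eq (reg 1)).not.and
      ((gadgetExpr L h (reg 0) (reg 1)).or (gadgetExpr L h (reg 1) (reg 0)))))) (lit 1) (lit 0)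

def detect (L h : ℕ) : RamCmd := .query 9 10 (orderExpr h) (accessor L h)

def answer (θ : ℕ) : RamExpr := ((lit θ).mul (reg 10)).lt (reg 9)

/-- The contents of the memory and of the registers that stay fixed while a triple is treated. -/
structure Frame (mem : ℕ → ℕ) (n σ nb T iB jB kB P : ℕ) (s : RamState) : Prop where
  mem : s.mem = mem
  n : s.reg 2 = n
  σ : s.reg 3 = σ
  nb : s.reg 4 = nb
  T : s.reg 5 = T
  iB : s.reg 11 = iB
  jB : s.reg 12 = jB
  kB : s.reg 13 = kB
  P : s.reg 14 = P

/-- No overflow occurs in the evaluation of the accessor. -/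
structure Fits (W n σ iB jB kB P L h : ℕ) : Prop where
  one : 4 < W
  cell : (iB + σ) * n + (kB + σ) < W
  iOff : iB + σ < W
  jOff : jB + σ < W
  pair : 2 * (σ * σ) + σ < W
  triple : 3 * σ < W
  order : 4 * P + h < W
  copies : L < W

variable {W : ℕ} {input : ℕ → ℕ → ℕ → ℕ} {ext : ℕ → (ℕ → ℕ → ℕ) → ℕ → ℕ → ℕ → Prop}
  {m : ℕ → ℕ} {n σ nb T iB jB kB P L h θ : ℕ} {s : RamState}

theorem Frame.update (hs : Frame m n σ nb T iB jB kB P s) {r x : ℕ}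
    (hr : r = 0 ∨ r = 1 ∨ (6 ≤ r ∧ r ≤ 10)) :
    Frame m n σ nb T iB jB kB P { s with reg := Function.update s.reg r x } where
  mem := hs.mem
  n := by simpa [Function.update_of_ne (show 2 ≠ r by omega)] using hs.n
  σ := by simpa [Function.update_of_ne (show 3 ≠ r by omega)] using hs.σ
  nb := by simpa [Function.update_of_ne (show 4 ≠ r by omega)] using hs.nb
  T := by simpa [Function.update_of_ne (show 5 ≠ r by omega)] using hs.T
  iB := by simpa [Function.update_of_ne (show 11 ≠ r by omega)] using hs.iB
  jB := by simpa [Function.update_of_ne (show 12 ≠ r by omega)] using hs.jB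
  kB := by simpa [Function.update_of_ne (show 13 ≠ r by omega)] using hs.kB
  P := by simpa [Function.update_of_ne (show 14 ≠ r by omega)] using hs.P

theorem eval_inp (hin : ∀ b i j, input b i j ≤ 1) (hW : 1 < W) {b i j : RamExpr} {x y z : ℕ}
    (hb : b.eval W input s = x) (hi : i.eval W input s = y) (hj : j.eval W input s = z) :
    (inp b i j).eval W input s ≠ 0 ↔ input x y z ≠ 0 := by
  rw [RamExpr.eval, hb, hi, hj, Nat.mod_eq_of_lt ((hin x y z).trans_lt hW)]

theorem eval_blockExpr (hs : Frame m n σ nb T iB jB kB P s) (hfit : Fits W n σ iB jB kB P L h)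
    (hin : ∀ b i j, input b i j ≤ 1) {e f : RamExpr} {a b : ℕ}
    (he : e.eval W input s = a) (hf : f.eval W input s = b) (ha : a < 3 * σ) (hb : b < 3 * σ) :
    (blockExpr e f).eval W input s ≠ 0 ↔
      blockRel input m n σ (s.reg 6) (s.reg 7) iB jB kB a b := by
  obtain ⟨hW, hcell, hi, hj, hpair, htr, -, -⟩ := hfit
  have hW1 : 1 < W := by omega
  have e3 : (reg 3).eval W input s = σ := hs.σ
  have e2 : ((lit 2).mul (reg 3)).eval W input s = 2 * σ :=
    eval_mul (eval_lit_of_lt (by omega)) e3 (by omega)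
  have e3' : ((lit 3).mul (reg 3)).eval W input s = 3 * σ :=
    eval_mul (eval_lit_of_lt (by omega)) e3 (by omega)
  have e11 : (reg 11).eval W input s = iB := hs.iB
  have e12 : (reg 12).eval W input s = jB := hs.jB
  have e13 : (reg 13).eval W input s = kB := hs.kB
  have en : (reg 2).eval W input s = n := hs.n
  have hfs : (f.sub (reg 3)).eval W input s = b - σ := eval_sub hf e3 (by omega)
  have hes : (e.sub (reg 3)).eval W input s = a - σ := eval_sub he e3 (by omega)
  have hfs2 : (f.sub ((lit 2).mul (reg 3))).eval W input s = b - 2 * σ := eval_sub hf e2 (by omega)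
  have hk : ((reg 13).add (f.sub ((lit 2).mul (reg 3)))).eval W input s = kB + (b - 2 * σ) :=
    eval_add e13 hfs2 (by omega)
  have hmulle : a < σ → a * σ ≤ σ * σ := fun h => Nat.mul_le_mul_right _ h.le
  -- The overflow bound for the pair number relies on `a < σ`; the expression checks this
  -- beforehand.
  have hpr : a < σ →
      ((e.mul (reg 3)).add (f.sub ((lit 2).mul (reg 3)))).eval W input s = a * σ + (b - 2 * σ) := by
    intro h
    have := hmulle h
    exact eval_add (eval_mul he e3 (by omega)) hfs2 (by omega)
  refine eval_or hW1 ?_ (eval_or hW1 ?_ ?_)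
  · refine eval_and (eval_lt hW1 he e3) fun h1 => eval_and (eval_le_iff hW1 e3 hf) fun h2 =>
      eval_and (eval_lt hW1 hf e2) fun h3 => ?_
    exact eval_inp hin hW1 (eval_lit_of_lt (by omega)) (eval_add e11 he (by omega))
      (eval_add e12 hfs (by omega))
  · refine eval_and (eval_le_iff hW1 e3 he) fun h1 => eval_and (eval_lt hW1 he e2) fun h2 =>
      eval_and (eval_le_iff hW1 e2 hf) fun h3 => eval_and (eval_lt hW1 hf e3') fun h4 => ?_
    exact eval_inp hin hW1 (eval_lit_of_lt hW1) (eval_add e12 hes (by omega)) hk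
  · refine eval_and (eval_lt hW1 he e3) fun h1 => eval_and (eval_le_iff hW1 e2 hf) fun h2 =>
      eval_and (eval_lt hW1 hf e3') fun h3 => eval_and (eval_le_iff hW1 rfl (hpr h1)) fun h4 =>
      eval_and (eval_lt hW1 (hpr h1) rfl) fun h5 => ?_
    refine eval_eq hW1 ?_ (eval_lit_of_lt (by omega))
    have hle : (iB + a) * n ≤ (iB + σ) * n := Nat.mul_le_mul_right _ (by omega)
    rw [RamExpr.eval, hs.mem,
      eval_add (eval_mul (eval_add e11 he (by omega)) en (by omega)) hk (by omega)]

theorem eval_gadgetExpr (hs : Frame m n σ nb T iB jB kB P s) (hfit : Fits W n σ iB jB kB P L h)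
    (hin : ∀ b i j, input b i j ≤ 1) (hP : P = L * (3 * σ)) {e f : RamExpr} {u v : ℕ}
    (he : e.eval W input s = u) (hf : f.eval W input s = v) (hu : u < 4 * P + h)
    (hv : v < 4 * P + h) :
    (gadgetExpr L h e f).eval W input s ≠ 0 ↔
      gadgetRel (blockRel input m n σ (s.reg 6) (s.reg 7) iB jB kB) P L h u v := by
  have hW1 : 1 < W := by have := hfit.one; omega
  have hord := hfit.order
  have hone := hfit.one
  have eP : (reg 14).eval W input s = P := hs.P
  have eL : (lit L).eval W input s = L := eval_lit_of_lt hfit.copies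
  have e2 : ((lit 2).mul (reg 14)).eval W input s = 2 * P :=
    eval_mul (eval_lit_of_lt (by omega)) eP (by omega)
  have e3 : ((lit 3).mul (reg 14)).eval W input s = 3 * P :=
    eval_mul (eval_lit_of_lt (by omega)) eP (by omega)
  refine eval_or hW1 ?_ (eval_or hW1 ?_ (eval_or hW1 ?_ ?_))
  · refine eval_and (eval_lt hW1 he eP) fun h1 => eval_and (eval_lt hW1 hf eP) fun h2 => ?_
    exact eval_blockExpr hs hfit hin (eval_div he eL (by omega)) (eval_div hf eL (by omega))
      (Nat.div_lt_of_lt_mul (hP ▸ h1)) (Nat.div_lt_of_lt_mul (hP ▸ h2))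
  · exact eval_and (eval_lt hW1 he eP) fun h1 => eval_eq hW1 hf (eval_add he eP (by omega))
  · exact eval_and (eval_le_iff hW1 eP he) fun h1 => eval_and (eval_lt hW1 he e2) fun h2 =>
      eval_le_iff hW1 e2 hf
  · refine eval_and (eval_le_iff hW1 e2 he) fun h1 => eval_and (eval_lt hW1 he e3) fun h2 => ?_
    have e4 := eval_add he eP (by omega : u + P < W)
    exact eval_and (eval_le_iff hW1 e4 hf) fun h3 =>
      eval_lt hW1 hf (eval_add e4 (eval_lit_of_lt (by omega)) (by omega))

theorem eval_orderExpr (hs : Frame m n σ nb T iB jB kB P s) (hfit : Fits W n σ iB jB kB P L h) :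
    (orderExpr h).eval W input s = 4 * P + h := by
  have hord := hfit.order
  have hone := hfit.one
  exact eval_add (eval_mul (eval_lit_of_lt (by omega)) hs.P (by omega)) (eval_lit_of_lt (by omega))
    hord

theorem queryMatrix_accessor (hs : Frame m n σ nb T iB jB kB P s)
    (hfit : Fits W n σ iB jB kB P L h) (hin : ∀ b i j, input b i j ≤ 1) (hP : P = L * (3 * σ)) :
    queryMatrix W input s (accessor L h) = adjacencyInput
      (gadget (blockRel input m n σ (s.reg 6) (s.reg 7) iB jB kB) P L h) := by
  have hW1 : 1 < W := by have := hfit.one; omega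
  funext u v
  have hs' := (hs.update (r := 0) (x := u) (Or.inl rfl)).update (r := 1) (x := v) (Or.inr (Or.inl rfl))
  simp only at hs'
  unfold queryMatrix
  set s' : RamState := { s with reg := Function.update (Function.update s.reg 0 u) 1 v }
  have eu : (reg 0).eval W input s' = u := by simp [RamExpr.eval, s']
  have ev : (reg 1).eval W input s' = v := by simp [RamExpr.eval, s']
  have h6 : s'.reg 6 = s.reg 6 := by simp [s']
  have h7 : s'.reg 7 = s.reg 7 := by simp [s']
  have hN := eval_orderExpr (input := input) hs' hfit
  have key := eval_and (eval_lt hW1 eu hN) fun h1 => eval_and (eval_lt hW1 ev hN) fun h2 =>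
    eval_and (eval_not hW1 (eval_eq hW1 eu ev)) fun _ =>
      eval_or hW1 (eval_gadgetExpr hs' hfit hin hP eu ev h1 h2)
        (eval_gadgetExpr hs' hfit hin hP ev eu h2 h1)
  rw [h6, h7] at key
  rw [accessor, RamExpr.eval]
  unfold adjacencyInput
  classical
  refine if_congr (key.trans ?_) (eval_lit_of_lt hW1) (eval_lit_of_lt (by omega))
  simp only [gadget_adj, exists_prop, ne_eq]

/-- The external algorithm tells by its answer `a / b > θ` whether a triangle was planted in a gadget. -/
def Detects (W : ℕ) (ext : ℕ → (ℕ → ℕ → ℕ) → ℕ → ℕ → ℕ → Prop) (P σ L h θ Tq : ℕ) : Prop :=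
  ∀ F : ℕ → ℕ → Prop, (∀ a b, F a b → a < b ∧ b < 3 * σ) → ∃ a b τ,
    ext (4 * P + h) (adjacencyInput (gadget F P L h)) a b τ ∧ a < W ∧ b < W ∧ θ * b < W ∧
      (θ * b < a ↔ ∃ x y z, F x y ∧ F y z ∧ F x z) ∧ τ ≤ Tq

theorem reaches_detect {Tq : ℕ} (hs : Frame m n σ nb T iB jB kB P s)
    (hfit : Fits W n σ iB jB kB P L h) (hin : ∀ b i j, input b i j ≤ 1) (hP : P = L * (3 * σ))
    (hθ : θ < W) (hext : Detects W ext P σ L h θ Tq) :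
    Reaches W input ext (detect L h) s
      (fun s' => Frame m n σ nb T iB jB kB P s' ∧ s'.reg 6 = s.reg 6 ∧ s'.reg 7 = s.reg 7 ∧
        s'.reg 8 = s.reg 8 ∧ ((answer θ).eval W input s' ≠ 0 ↔
          ∃ p, s.reg 6 ≤ p ∧ p < s.reg 7 ∧ NewPair input m n σ iB jB kB p))
      ((orderExpr h).size + 1) (((accessor L h).size + 1) * Tq) := by
  have hW1 : 1 < W := by have := hfit.one; omega
  obtain ⟨a, b, τ, h1, ha, hb, hθb, h2, h3⟩ :=
    hext (blockRel input m n σ (s.reg 6) (s.reg 7) iB jB kB) fun _ _ => blockRel_lt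
  rw [← queryMatrix_accessor hs hfit hin hP, ← eval_orderExpr (input := input) hs hfit] at h1
  refine ⟨_, _, _, .query (p := 9) (q := 10) h1, ⟨?_, ?_, ?_, ?_, ?_⟩, le_rfl,
    Nat.mul_le_mul_left _ h3⟩
  · exact (hs.update (r := 9) (by omega)).update (r := 10) (by omega)
  · simp
  · simp
  · simp
  · rw [← exists_triangle_blockRel, ← h2]
    refine eval_lt hW1 (eval_mul (eval_lit_of_lt hθ) ?_ hθb) ?_
    · simp [RamExpr.eval, Nat.mod_eq_of_lt hb]
    · simp [RamExpr.eval, Nat.mod_eq_of_lt ha]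

end program

/-! ### The record of found pairs -/

/-- Each recorded cell is a one of the Boolean product, and all ones that are witnessed by the first `T`
triples of blocks are recorded. -/
structure Record (inp : ℕ → ℕ → ℕ → ℕ) (n σ nb T : ℕ) (mem : ℕ → ℕ) : Prop where
  sound : ∀ c < n * n, mem c ≠ 0 → mem c = 1 ∧ ∃ l, inp 0 (c / n) l ≠ 0 ∧ inp 1 l (c % n) ≠ 0
  complete : ∀ i j k, inp 0 i j ≠ 0 → inp 1 j k ≠ 0 → (i / σ * nb + j / σ) * nb + k / σ < T →
    mem (i * n + k) ≠ 0

/-- The number of cells that are not recorded. -/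
def blanks (n : ℕ) (mem : ℕ → ℕ) : ℕ := ((Finset.range (n * n)).filter fun c => mem c = 0).card

theorem blanks_le (n : ℕ) (mem : ℕ → ℕ) : blanks n mem ≤ n * n :=
  (Finset.card_filter_le _ _).trans (Finset.card_range _).le

theorem blanks_update_lt {n c : ℕ} {mem : ℕ → ℕ} (hc : c < n * n) (h : mem c = 0) :
    blanks n (Function.update mem c 1) < blanks n mem := by
  refine Finset.card_lt_card ⟨fun x hx => ?_, fun hsub => ?_⟩
  · simp only [Finset.mem_filter] at hx ⊢
    refine ⟨hx.1, ?_⟩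
    by_cases hxc : x = c
    · rw [hxc, h]
    · simpa [Function.update_of_ne hxc] using hx.2
  · have := hsub (Finset.mem_filter.mpr ⟨Finset.mem_range.mpr hc, h⟩)
    simp at this

section record

variable {inp : ℕ → ℕ → ℕ → ℕ} {n σ nb T : ℕ} {mem : ℕ → ℕ}

/-- `T` is a three-digit number in base `nb` whose digits are the block indices. A path `i, j, k`
through triple `T` with a blank cell would be a new pair, with `i % σ`, `j % σ`, `k % σ` as
positions in the blocks. -/
theorem Record.succ (hr : Record inp n σ nb T mem) (hrange : ∀ b i j, inp b i j ≠ 0 → i < n ∧ j < n)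
    (hσ : 0 < σ) (hnb : n < nb * σ)
    (hno : ¬ ∃ p, 0 ≤ p ∧ p < σ * σ ∧
      NewPair inp mem n σ (T / nb / nb * σ) (T / nb % nb * σ) (T % nb * σ) p) :
    Record inp n σ nb (T + 1) mem := by
  refine ⟨hr.sound, fun i j k h0 h1 hT => ?_⟩
  rcases Nat.lt_succ_iff_lt_or_eq.mp hT with hT | hT
  · exact hr.complete i j k h0 h1 hT
  intro hmem
  have hj : j / σ < nb := Nat.div_lt_of_lt_mul (by rw [mul_comm]; exact (hrange _ _ _ h0).2.trans hnb)
  have hk : k / σ < nb := Nat.div_lt_of_lt_mul (by rw [mul_comm]; exact (hrange _ _ _ h1).2.trans hnb)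
  have hnb0 : 0 < nb := (Nat.zero_le _).trans_lt hj
  have e1 : T % nb = k / σ := by rw [← hT, mul_comm, Nat.mul_add_mod, Nat.mod_eq_of_lt hk]
  have e2 : T / nb = i / σ * nb + j / σ := by
    rw [← hT, mul_comm, Nat.mul_add_div hnb0, Nat.div_eq_of_lt hk, add_zero]
  have e3 : T / nb % nb = j / σ := by rw [e2, mul_comm, Nat.mul_add_mod, Nat.mod_eq_of_lt hj]
  have e4 : T / nb / nb = i / σ := by
    rw [e2, mul_comm, Nat.mul_add_div hnb0, Nat.div_eq_of_lt hj, add_zero]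
  have hm : k % σ < σ := Nat.mod_lt _ hσ
  have f1 : (i % σ * σ + k % σ) / σ = i % σ := by
    rw [mul_comm, Nat.mul_add_div hσ, Nat.div_eq_of_lt hm, add_zero]
  have f2 : (i % σ * σ + k % σ) % σ = k % σ := by rw [mul_comm, Nat.mul_add_mod, Nat.mod_eq_of_lt hm]
  have hp : i % σ * σ + k % σ < σ * σ := by
    calc i % σ * σ + k % σ < i % σ * σ + σ := by omega
      _ = (i % σ + 1) * σ := by ring
      _ ≤ σ * σ := Nat.mul_le_mul_right _ (Nat.mod_lt _ hσ)
  refine hno ⟨i % σ * σ + k % σ, Nat.zero_le _, hp, hp, ?_, j % σ, Nat.mod_lt _ hσ, ?_, ?_⟩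
  · rwa [f1, f2, e1, e4, Nat.div_add_mod', Nat.div_add_mod']
  · rwa [f1, e4, e3, Nat.div_add_mod', Nat.div_add_mod']
  · rwa [f2, e1, e3, Nat.div_add_mod', Nat.div_add_mod']

theorem Record.update (hr : Record inp n σ nb T mem)
    (hrange : ∀ b i j, inp b i j ≠ 0 → i < n ∧ j < n) {iB jB kB p : ℕ}
    (hp : NewPair inp mem n σ iB jB kB p) :
    Record inp n σ nb T (Function.update mem ((iB + p / σ) * n + (kB + p % σ)) 1) ∧
      blanks n (Function.update mem ((iB + p / σ) * n + (kB + p % σ)) 1) < blanks n mem := by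
  obtain ⟨-, hmem, j, -, h0, h1⟩ := hp
  generalize iB + p / σ = i at *
  generalize kB + p % σ = k at *
  generalize jB + j = l at *
  have hi := (hrange _ _ _ h0).1
  have hk := (hrange _ _ _ h1).2
  have hc : i * n + k < n * n := by
    calc i * n + k < i * n + n := by omega
      _ = (i + 1) * n := by ring
      _ ≤ n * n := Nat.mul_le_mul_right _ hi
  have hn : 0 < n := by omega
  refine ⟨⟨fun c hcn hc0 => ?_, fun i' j' k' h0' h1' hT => ?_⟩, blanks_update_lt hc hmem⟩
  · by_cases hcc : c = i * n + k
    · subst hcc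
      refine ⟨by simp, l, ?_, ?_⟩
      · rwa [mul_comm, Nat.mul_add_div hn, Nat.div_eq_of_lt hk, add_zero]
      · rwa [mul_comm, Nat.mul_add_mod, Nat.mod_eq_of_lt hk]
    · rw [Function.update_of_ne hcc] at hc0 ⊢
      exact hr.sound c hcn hc0
  · by_cases hcc : i' * n + k' = i * n + k
    · rw [hcc]
      simp
    · rw [Function.update_of_ne hcc]
      exact hr.complete i' j' k' h0' h1' hT

end record

/-! ### Binary search for a new pair -/

section program

open RamExpr

def searchStep (L h θ : ℕ) : RamCmd :=
  .seq (.assign 7 (((reg 6).add (reg 8)).div (lit 2)))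
    (.seq (detect L h) (.branch (answer θ) (.assign 8 (reg 7)) (.assign 6 (reg 7))))

def searchTest : RamExpr := ((reg 6).add (lit 1)).lt (reg 8)

def search (L h θ : ℕ) : RamCmd := .loop searchTest (searchStep L h θ)

/-- The number of own steps of a loop-free command. -/
def RamCmd.cost : RamCmd → ℕ
  | .skip => 1
  | .assign _ e => e.size + 1
  | .store a e => a.size + e.size + 1
  | .seq x y => x.cost + y.cost
  | .branch e x y => e.size + 1 + max x.cost y.cost
  | .loop _ _ => 0
  | .query _ _ N _ => N.size + 1

variable {W : ℕ} {input : ℕ → ℕ → ℕ → ℕ} {ext : ℕ → (ℕ → ℕ → ℕ) → ℕ → ℕ → ℕ → Prop}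
  {m : ℕ → ℕ} {n σ nb T iB jB kB P L h θ : ℕ} {s : RamState}

theorem reaches_searchStep {Tq : ℕ} (hs : Frame m n σ nb T iB jB kB P s)
    (hfit : Fits W n σ iB jB kB P L h) (hin : ∀ b i j, input b i j ≤ 1) (hP : P = L * (3 * σ))
    (hθ : θ < W) (hext : Detects W ext P σ L h θ Tq) (h8 : s.reg 8 ≤ σ * σ)
    (hex : ∃ p, s.reg 6 ≤ p ∧ p < s.reg 8 ∧ NewPair input m n σ iB jB kB p)
    (hlt : s.reg 6 + 1 < s.reg 8) :
    Reaches W input ext (searchStep L h θ) s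
      (fun s' => (Frame m n σ nb T iB jB kB P s' ∧ s'.reg 8 ≤ σ * σ ∧
        ∃ p, s'.reg 6 ≤ p ∧ p < s'.reg 8 ∧ NewPair input m n σ iB jB kB p) ∧
        Nat.clog 2 (s'.reg 8 - s'.reg 6) < Nat.clog 2 (s.reg 8 - s.reg 6))
      (searchStep L h θ).cost (((accessor L h).size + 1) * Tq) := by
  have hone := hfit.one
  have hpair := hfit.pair
  -- Halving an interval of length at least two, rounded up, lowers `Nat.clog 2` by at least one;
  -- both halves are this short.
  have hclog : ∀ d, d ≤ (s.reg 8 - s.reg 6 + 1) / 2 →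
      Nat.clog 2 d < Nat.clog 2 (s.reg 8 - s.reg 6) := by
    intro d hd
    rw [Nat.clog_of_two_le one_lt_two (by omega : 2 ≤ s.reg 8 - s.reg 6), Nat.lt_succ_iff]
    exact Nat.clog_mono_right 2 (by simpa using hd)
  have hmid : (((reg 6).add (reg 8)).div (lit 2)).eval W input s = (s.reg 6 + s.reg 8) / 2 :=
    eval_div (eval_add rfl rfl (by omega)) (eval_lit_of_lt (by omega)) (by omega)
  refine (Reaches.seq (T₁' := 0) (T₂' := ((accessor L h).size + 1) * Tq + 0)
    (Reaches.assign hmid (Reaches.seq ?_))).mono (fun _ h => h) le_rfl (by omega)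
  set s₁ : RamState := { s with reg := Function.update s.reg 7 ((s.reg 6 + s.reg 8) / 2) }
  have hs₁ : Frame m n σ nb T iB jB kB P s₁ := hs.update (by omega)
  have h16 : s₁.reg 6 = s.reg 6 := by simp [s₁]
  have h17 : s₁.reg 7 = (s.reg 6 + s.reg 8) / 2 := by simp [s₁]
  have h18 : s₁.reg 8 = s.reg 8 := by simp [s₁]
  refine (reaches_detect hs₁ hfit hin hP hθ hext).mono ?_ le_rfl le_rfl
  rintro s₂ ⟨hs₂, h26, h27, h28, hans⟩
  rw [h16] at h26
  rw [h17] at h27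
  rw [h18] at h28
  rw [h16, h17] at hans
  obtain ⟨p, hp1, hp2, hp3⟩ := hex
  refine Reaches.branch (fun hyes => ?_) (fun hno => ?_)
  · refine (Reaches.assign (v := (s.reg 6 + s.reg 8) / 2)
      (show (reg 7).eval W input s₂ = _ from h27) ?_).mono (fun _ h => h)
      (le_max_left _ _) le_rfl
    refine ⟨⟨hs₂.update (by omega), ?_, ?_⟩, ?_⟩
    · simp; omega
    · simpa [h26] using hans.mp hyes
    · apply hclog
      simp [h26]
      omega
  · refine (Reaches.assign (v := (s.reg 6 + s.reg 8) / 2)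
      (show (reg 7).eval W input s₂ = _ from h27) ?_).mono (fun _ h => h)
      (le_max_right _ _) le_rfl
    -- The lower half has no new pair, so the known one lies in the upper half.
    have hge : (s.reg 6 + s.reg 8) / 2 ≤ p := by
      by_contra! hlt'
      exact hans.mpr ⟨p, hp1, hlt', hp3⟩ hno
    refine ⟨⟨hs₂.update (by omega), ?_, p, ?_, ?_, hp3⟩, ?_⟩
    · simpa [h28] using h8
    · simpa using hge
    · simpa [h28] using hp2
    · apply hclog
      simp [h28]
      omega

theorem reaches_search {Tq : ℕ} (hs : Frame m n σ nb T iB jB kB P s)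
    (hfit : Fits W n σ iB jB kB P L h) (hin : ∀ b i j, input b i j ≤ 1) (hP : P = L * (3 * σ))
    (hθ : θ < W) (hext : Detects W ext P σ L h θ Tq) (h8 : s.reg 8 ≤ σ * σ)
    (hex : ∃ p, s.reg 6 ≤ p ∧ p < s.reg 8 ∧ NewPair input m n σ iB jB kB p) :
    Reaches W input ext (search L h θ) s
      (fun s' => Frame m n σ nb T iB jB kB P s' ∧ NewPair input m n σ iB jB kB (s'.reg 6))
      (Nat.clog 2 (σ * σ) * (searchTest.size + 1 + (searchStep L h θ).cost) + (searchTest.size + 1))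
      (Nat.clog 2 (σ * σ) * (((accessor L h).size + 1) * Tq)) := by
  have hone := hfit.one
  have hpair := hfit.pair
  have htest : ∀ s : RamState, s.reg 6 < s.reg 8 → s.reg 8 ≤ σ * σ →
      (searchTest.eval W input s ≠ 0 ↔ s.reg 6 + 1 < s.reg 8) := fun s h1 h2 =>
    eval_lt (by omega) (eval_add rfl (eval_lit_of_lt (by omega)) (by omega)) rfl
  refine (Reaches.loop (fun s' => Frame m n σ nb T iB jB kB P s' ∧ s'.reg 8 ≤ σ * σ ∧
      ∃ p, s'.reg 6 ≤ p ∧ p < s'.reg 8 ∧ NewPair input m n σ iB jB kB p)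
    (fun s' => Nat.clog 2 (s'.reg 8 - s'.reg 6)) ?_ _ s ⟨hs, h8, hex⟩
    (Nat.clog_mono_right 2 ((Nat.sub_le _ _).trans h8))).mono ?_ le_rfl le_rfl
  · rintro s' ⟨hs', h8', p, hp1, hp2, hp3⟩ htrue
    exact reaches_searchStep hs' hfit hin hP hθ hext h8' ⟨p, hp1, hp2, hp3⟩
      ((htest s' (by omega) h8').mp htrue)
  · rintro s' ⟨⟨hs', h8', p, hp1, hp2, hp3⟩, hfalse⟩
    refine ⟨hs', ?_⟩
    have : ¬ s'.reg 6 + 1 < s'.reg 8 := fun h => (htest s' (by omega) h8').mpr h hfalse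
    rwa [show s'.reg 6 = p by omega]

/-! ### The main loop -/

def setup : RamCmd :=
  .seq (.assign 11 ((((reg 5).div (reg 4)).div (reg 4)).mul (reg 3)))
    (.seq (.assign 12 ((((reg 5).div (reg 4)).mod (reg 4)).mul (reg 3)))
      (.seq (.assign 13 (((reg 5).mod (reg 4)).mul (reg 3)))
        (.seq (.assign 6 (lit 0))
          (.seq (.assign 7 ((reg 3).mul (reg 3))) (.assign 8 (reg 7))))))

def cellExpr : RamExpr :=
  (((reg 11).add ((reg 6).div (reg 3))).mul (reg 2)).add ((reg 13).add ((reg 6).mod (reg 3)))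

def treat (L h θ : ℕ) : RamCmd :=
  .seq setup (.seq (detect L h) (.branch (answer θ)
    (.seq (search L h θ) (.store cellExpr (lit 1))) (.assign 5 ((reg 5).add (lit 1)))))

def mainTest : RamExpr := (reg 5).lt (((reg 4).mul (reg 4)).mul (reg 4))

def mainLoop (L h θ : ℕ) : RamCmd := .loop mainTest (treat L h θ)

/-- No overflow occurs in the whole program. -/
structure Room (W n σ nb P L h θ : ℕ) : Prop where
  one : 4 < W
  cell : 2 * n * n + 2 * n < W
  blocks : nb * σ ≤ 2 * n
  triples : nb * nb * nb < W
  pair : 2 * (σ * σ) + σ < W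
  triple : 3 * σ < W
  order : 4 * P + h < W
  copies : L < W
  threshold : θ < W

/-- The last block may reach beyond `n`, but no block ends beyond `2 * n`, so the cell numbers
formed stay below `W`. -/
theorem Room.fits (hr : Room W n σ nb P L h θ) {i j k : ℕ} (hi : i < nb) (hj : j < nb) (hk : k < nb) :
    Fits W n σ (i * σ) (j * σ) (k * σ) P L h := by
  obtain ⟨h1, h2, h3, h4, h5, h6, h7, h8, h9⟩ := hr
  have key : ∀ x < nb, x * σ + σ ≤ 2 * n := fun x hx =>
    calc x * σ + σ = (x + 1) * σ := by ring
      _ ≤ nb * σ := Nat.mul_le_mul_right _ hx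
      _ ≤ 2 * n := h3
  have ki := key i hi
  have kj := key j hj
  have kk := key k hk
  have hcell : (i * σ + σ) * n ≤ 2 * n * n := Nat.mul_le_mul_right _ ki
  exact ⟨h1, by omega, by omega, by omega, h5, h6, h7, h8⟩

theorem reaches_setup (hroom : Room W n σ nb P L h θ) (hn : s.reg 2 = n) (hσ : s.reg 3 = σ)
    (hnb : s.reg 4 = nb) (hT : s.reg 5 = T) (hP : s.reg 14 = P) (hlt : T < nb * nb * nb) :
    Reaches W input ext setup s (fun s' => Frame s.mem n σ nb T (T / nb / nb * σ) (T / nb % nb * σ)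
      (T % nb * σ) P s' ∧ s'.reg 6 = 0 ∧ s'.reg 7 = σ * σ ∧ s'.reg 8 = σ * σ) setup.cost 0 := by
  have hone := hroom.one
  have htr := hroom.triples
  have hpair := hroom.pair
  have hcell := hroom.cell
  have hnb0 : 0 < nb := Nat.pos_of_ne_zero (by rintro rfl; omega)
  have h1 : T / nb / nb < nb := Nat.div_lt_of_lt_mul (Nat.div_lt_of_lt_mul (by rwa [← mul_assoc]))
  have hle : ∀ x < nb, x * σ < W := fun x hx =>
    ((Nat.mul_le_mul_right _ hx.le).trans hroom.blocks).trans_lt (by omega)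
  have hdiv : T / nb ≤ T := Nat.div_le_self _ _
  refine (Reaches.seq (T₁' := 0) (T₂' := 0) (Reaches.assign (v := T / nb / nb * σ) ?_
    (Reaches.seq (T₁' := 0) (T₂' := 0) (Reaches.assign (v := T / nb % nb * σ) ?_
    (Reaches.seq (T₁' := 0) (T₂' := 0) (Reaches.assign (v := T % nb * σ) ?_
    (Reaches.seq (T₁' := 0) (T₂' := 0) (Reaches.assign (v := 0) ?_
    (Reaches.seq (T₁' := 0) (T₂' := 0) (Reaches.assign (v := σ * σ) ?_
    (Reaches.assign (v := σ * σ) ?_ ?_))))))))))).mono (fun _ h => h) le_rfl le_rfl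
  · exact eval_mul (eval_div (eval_div (by simp [RamExpr.eval, hT]) (by simp [RamExpr.eval, hnb])
      (by omega)) (by simp [RamExpr.eval, hnb]) (by omega)) (by simp [RamExpr.eval, hσ]) (hle _ h1)
  · exact eval_mul (eval_mod (eval_div (by simp [RamExpr.eval, hT]) (by simp [RamExpr.eval, hnb])
      (by omega)) (by simp [RamExpr.eval, hnb]) (by omega)) (by simp [RamExpr.eval, hσ])
      (hle _ (Nat.mod_lt _ hnb0))
  · exact eval_mul (eval_mod (by simp [RamExpr.eval, hT]) (by simp [RamExpr.eval, hnb])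
      (by omega)) (by simp [RamExpr.eval, hσ]) (hle _ (Nat.mod_lt _ hnb0))
  · exact eval_lit_of_lt (by omega)
  · exact eval_mul (by simp [RamExpr.eval, hσ]) (by simp [RamExpr.eval, hσ]) (by omega)
  · simp [RamExpr.eval]
  · refine ⟨⟨rfl, ?_, ?_, ?_, ?_, ?_, ?_, ?_, ?_⟩, ?_, ?_, ?_⟩ <;> simp [*]

/-- The invariant of the main loop. -/
structure MainInv (input : ℕ → ℕ → ℕ → ℕ) (n σ nb P : ℕ) (s : RamState) : Prop where
  reg_n : s.reg 2 = n
  reg_σ : s.reg 3 = σ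
  reg_nb : s.reg 4 = nb
  reg_P : s.reg 14 = P
  le : s.reg 5 ≤ nb * nb * nb
  record : Record input n σ nb (s.reg 5) s.mem

def searchCost (L h θ : ℕ) : ℕ := searchTest.size + 1 + (searchStep L h θ).cost

def treatCost (L h θ : ℕ) : ℕ :=
  setup.cost + ((detect L h).cost + ((answer θ).size + 1 +
    (searchTest.size + 1 + (cellExpr.size + 2) + ((reg 5).add (lit 1)).size + 1)))

/-- The potential counts untreated triples plus blank cells: a found pair fills a cell and leaves
`T` unchanged, a negative answer advances `T`. -/
theorem reaches_treat {Tq : ℕ} (hroom : Room W n σ nb P L h θ) (hin : ∀ b i j, input b i j ≤ 1)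
    (hrange : ∀ b i j, input b i j ≠ 0 → i < n ∧ j < n) (hσ : 0 < σ) (hnb : n < nb * σ)
    (hP : P = L * (3 * σ)) (hext : Detects W ext P σ L h θ Tq) (hs : MainInv input n σ nb P s)
    (hlt : s.reg 5 < nb * nb * nb) :
    Reaches W input ext (treat L h θ) s
      (fun s' => MainInv input n σ nb P s' ∧ nb * nb * nb - s'.reg 5 + blanks n s'.mem <
        nb * nb * nb - s.reg 5 + blanks n s.mem)
      (treatCost L h θ + Nat.clog 2 (σ * σ) * searchCost L h θ)
      ((1 + Nat.clog 2 (σ * σ)) * (((accessor L h).size + 1) * Tq)) := by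
  have hone := hroom.one
  have htr := hroom.triples
  have hnb0 : 0 < nb := Nat.pos_of_ne_zero (by rintro rfl; omega)
  have h1 : s.reg 5 / nb / nb < nb :=
    Nat.div_lt_of_lt_mul (Nat.div_lt_of_lt_mul (by rwa [← mul_assoc]))
  have hfit := hroom.fits h1 (Nat.mod_lt (s.reg 5 / nb) hnb0) (Nat.mod_lt (s.reg 5) hnb0)
  have hsetup := reaches_setup (input := input) (ext := ext) hroom hs.reg_n hs.reg_σ hs.reg_nb rfl hs.reg_P hlt
  refine (Reaches.seq (T₁ := setup.cost) (T₁' := 0)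
    (T₂ := (detect L h).cost + ((answer θ).size + 1 +
      ((searchTest.size + 1 + (cellExpr.size + 2) + ((reg 5).add (lit 1)).size + 1) +
        Nat.clog 2 (σ * σ) * searchCost L h θ)))
    (T₂' := ((accessor L h).size + 1) * Tq + Nat.clog 2 (σ * σ) * (((accessor L h).size + 1) * Tq))
    (hsetup.mono ?_ le_rfl le_rfl)).mono (fun _ h => h)
    (by unfold treatCost; omega) (le_of_eq (by ring))
  rintro s₁ ⟨hs₁, h16, h17, h18⟩
  refine Reaches.seq ((reaches_detect hs₁ hfit hin hP hroom.threshold hext).mono ?_ le_rfl le_rfl)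
  rintro s₂ ⟨hs₂, h26, h27, h28, hans⟩
  rw [h16, h17] at hans
  refine Reaches.branch (fun hyes => ?_) (fun hno => ?_)
  · obtain hex := hans.mp hyes
    refine (Reaches.seq (T₁' := Nat.clog 2 (σ * σ) * (((accessor L h).size + 1) * Tq)) (T₂' := 0)
      ((reaches_search hs₂ hfit hin hP hroom.threshold hext (by rw [h28, h18])
        (by rw [h26, h28, h16, h18]; exact hex)).mono ?_ le_rfl le_rfl)).mono (fun _ h => h)
        (T₁ := _ + (cellExpr.size + 1 + 1)) ?_ (by omega)
    · rintro s₃ ⟨hs₃, hnew⟩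
      obtain ⟨hrec, hbl⟩ := hs.record.update hrange hnew
      have hp := hnew.1
      have hd : s₃.reg 6 / σ < σ := Nat.div_lt_of_lt_mul hp
      have hm : s₃.reg 6 % σ < σ := Nat.mod_lt _ hσ
      have hcell := hfit.cell
      have hpair := hfit.pair
      have hioff := hfit.iOff
      have hle : (s.reg 5 / nb / nb * σ + s₃.reg 6 / σ) * n ≤ (s.reg 5 / nb / nb * σ + σ) * n :=
        Nat.mul_le_mul_right _ (by omega)
      refine Reaches.store (u := (s.reg 5 / nb / nb * σ + s₃.reg 6 / σ) * n +
        (s.reg 5 % nb * σ + s₃.reg 6 % σ)) (v := 1) ?_ (eval_lit_of_lt (by omega)) ?_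
      · exact eval_add (eval_mul (eval_add hs₃.iB (eval_div rfl hs₃.σ (by omega)) (by omega)) hs₃.n
          (by omega)) (eval_add hs₃.kB (eval_mod rfl hs₃.σ (by omega)) (by omega)) (by omega)
      · refine ⟨⟨hs₃.n, hs₃.σ, hs₃.nb, hs₃.P, ?_, ?_⟩, ?_⟩
        · simpa [hs₃.T] using hs.le
        · simpa [hs₃.T, hs₃.mem] using hrec
        · simpa [hs₃.T, hs₃.mem] using hbl
    · unfold searchCost; omega
  · have hno' := mt hans.mpr (not_not.mpr hno)
    refine (Reaches.assign (v := s.reg 5 + 1)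
      (eval_add (show (reg 5).eval W input s₂ = _ from hs₂.T) (eval_lit_of_lt (by omega)) (by omega)) ?_).mono (fun _ h => h)
      (by omega) (Nat.zero_le _)
    refine ⟨⟨?_, ?_, ?_, ?_, ?_, ?_⟩, ?_⟩
    · simpa using hs₂.n
    · simpa using hs₂.σ
    · simpa using hs₂.nb
    · simpa using hs₂.P
    · simpa using hlt
    · simpa [hs₂.mem] using hs.record.succ hrange hσ hnb hno'
    · simp [hs₂.mem]
      omega

theorem reaches_mainLoop {Tq : ℕ} (hroom : Room W n σ nb P L h θ) (hin : ∀ b i j, input b i j ≤ 1)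
    (hrange : ∀ b i j, input b i j ≠ 0 → i < n ∧ j < n) (hσ : 0 < σ) (hnb : n < nb * σ)
    (hP : P = L * (3 * σ)) (hext : Detects W ext P σ L h θ Tq) (hs : MainInv input n σ nb P s) :
    Reaches W input ext (mainLoop L h θ) s (fun s' => Record input n σ nb (nb * nb * nb) s'.mem)
      ((nb * nb * nb + n * n) * (mainTest.size + 1 +
        (treatCost L h θ + Nat.clog 2 (σ * σ) * searchCost L h θ)) + (mainTest.size + 1))
      ((nb * nb * nb + n * n) *
        ((1 + Nat.clog 2 (σ * σ)) * (((accessor L h).size + 1) * Tq))) := by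
  have hone := hroom.one
  have htr := hroom.triples
  have hle : nb * nb ≤ nb * nb * nb := by
    rcases Nat.eq_zero_or_pos nb with rfl | h
    · simp
    · exact Nat.le_mul_of_pos_right _ h
  have htest : ∀ s : RamState, s.reg 4 = nb →
      (mainTest.eval W input s ≠ 0 ↔ s.reg 5 < nb * nb * nb) := fun s h4 =>
    eval_lt (by omega) rfl (eval_mul (eval_mul h4 h4 (by omega)) h4 (by omega))
  refine (Reaches.loop (MainInv input n σ nb P)
    (fun s' => nb * nb * nb - s'.reg 5 + blanks n s'.mem) ?_ _ s hs
    (Nat.add_le_add (Nat.sub_le _ _) (blanks_le _ _))).mono ?_ le_rfl le_rfl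
  · intro s' hs' htrue
    exact reaches_treat hroom hin hrange hσ hnb hP hext hs' ((htest s' hs'.reg_nb).mp htrue)
  · rintro s' ⟨hs', hfalse⟩
    have : ¬ s'.reg 5 < nb * nb * nb := fun h => (htest s' hs'.reg_nb).mpr h hfalse
    have heq : s'.reg 5 = nb * nb * nb := le_antisymm hs'.le (not_lt.mp this)
    exact heq ▸ hs'.record

end program

section program

open RamExpr

variable {W : ℕ} {input : ℕ → ℕ → ℕ → ℕ} {ext : ℕ → (ℕ → ℕ → ℕ) → ℕ → ℕ → ℕ → Prop}
  {n L h θ : ℕ} {s : RamState}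

/-! ### The whole program -/

def rootTest : RamExpr :=
  ((((reg 3).add (lit 1)).mul ((reg 3).add (lit 1))).mul ((reg 3).add (lit 1))).le (reg 2)

def rootStep : RamCmd := .assign 3 ((reg 3).add (lit 1))

def rootLoop : RamCmd := .loop rootTest rootStep

/-- Boolean matrix multiplication: compute the block length, then treat all triples of blocks. -/
def bmmProgram (L h θ : ℕ) : RamCmd :=
  .seq (.assign 2 (reg 0)) (.seq rootLoop (.seq (.assign 4 (((reg 2).div (reg 3)).add (lit 1)))
    (.seq (.assign 14 ((lit L).mul ((lit 3).mul (reg 3)))) (mainLoop L h θ))))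

/-- `σ` is the integral part of the cube root of `n`. -/
def IsRoot (n σ : ℕ) : Prop := σ * σ * σ ≤ n ∧ n < (σ + 1) * (σ + 1) * (σ + 1)

theorem IsRoot.pos {σ : ℕ} (hn : 1 ≤ n) (h : IsRoot n σ) : 0 < σ := by
  rcases Nat.eq_zero_or_pos σ with rfl | h0
  · have := h.2
    omega
  · exact h0

theorem IsRoot.le {σ : ℕ} (h : IsRoot n σ) : σ * σ ≤ n ∧ σ ≤ n := by
  rcases Nat.eq_zero_or_pos σ with rfl | h0
  · simp
  · have h1 : σ * σ ≤ σ * σ * σ := Nat.le_mul_of_pos_right _ h0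
    have h2 : σ ≤ σ * σ := Nat.le_mul_of_pos_right _ h0
    have := h.1
    omega

theorem IsRoot.blocks_mul_le {σ : ℕ} (h : IsRoot n σ) : (n / σ + 1) * σ ≤ 2 * n := by
  have h1 := Nat.div_mul_le_self n σ
  have h2 := h.le.2
  rw [Nat.add_mul]
  omega

/-- With `b` blocks, `b * σ ≤ 2 * n` and `n ≤ 8 * σ ^ 3` give `b ^ 3 * n ≤ 8 * (b * σ) ^ 3 ≤ 64 * n
^ 3`. -/
theorem IsRoot.blocks_le {σ : ℕ} (hn : 1 ≤ n) (h : IsRoot n σ) :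
    (n / σ + 1) * (n / σ + 1) * (n / σ + 1) ≤ 64 * (n * n) := by
  have hσ := h.pos hn
  have h1 := h.blocks_mul_le
  generalize n / σ + 1 = b at *
  have h2 : n ≤ 8 * (σ * σ * σ) := by
    have h3 : (σ + 1) * (σ + 1) * (σ + 1) ≤ (2 * σ) * (2 * σ) * (2 * σ) := by
      have h4 : σ + 1 ≤ 2 * σ := by omega
      exact Nat.mul_le_mul (Nat.mul_le_mul h4 h4) h4
    calc n ≤ (σ + 1) * (σ + 1) * (σ + 1) := h.2.le
      _ ≤ _ := h3
      _ = _ := by ring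
  refine Nat.le_of_mul_le_mul_right (c := n) ?_ hn
  calc b * b * b * n ≤ b * b * b * (8 * (σ * σ * σ)) := Nat.mul_le_mul_left _ h2
    _ = 8 * ((b * σ) * (b * σ) * (b * σ)) := by ring
    _ ≤ 8 * ((2 * n) * (2 * n) * (2 * n)) :=
      Nat.mul_le_mul_left _ (Nat.mul_le_mul (Nat.mul_le_mul h1 h1) h1)
    _ = 64 * (n * n) * n := by ring

theorem reaches_rootLoop (hn : 1 ≤ n) (hW : 8 * n < W) (h2 : s.reg 2 = n) (h3 : s.reg 3 = 0)
    (h5 : s.reg 5 = 0) :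
    Reaches W input ext rootLoop s
      (fun s' => s'.reg 2 = n ∧ IsRoot n (s'.reg 3) ∧ s'.reg 5 = 0 ∧ s'.mem = s.mem)
      (n * (rootTest.size + 1 + rootStep.cost) + (rootTest.size + 1)) (n * 0) := by
  have hle : ∀ x, x * x * x ≤ n → x ≤ n ∧ x * x ≤ n := by
    intro x hx
    rcases Nat.eq_zero_or_pos x with rfl | h0
    · simp
    · have h1 : x * x ≤ x * x * x := Nat.le_mul_of_pos_right _ h0
      have h2 : x ≤ x * x := Nat.le_mul_of_pos_right _ h0
      omega
  have htest : ∀ s : RamState, s.reg 2 = n → s.reg 3 * s.reg 3 * s.reg 3 ≤ n →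
      (rootTest.eval W input s ≠ 0 ↔
        (s.reg 3 + 1) * (s.reg 3 + 1) * (s.reg 3 + 1) ≤ n) := by
    intro s h2 h3
    obtain ⟨h4, h5⟩ := hle _ h3
    have e1 : ((reg 3).add (lit 1)).eval W input s = s.reg 3 + 1 :=
      eval_add rfl (eval_lit_of_lt (by omega)) (by omega)
    have e2 : (s.reg 3 + 1) * (s.reg 3 + 1) < W := by
      calc (s.reg 3 + 1) * (s.reg 3 + 1) = s.reg 3 * s.reg 3 + 2 * s.reg 3 + 1 := by ring
        _ < W := by omega
    have e3 : (s.reg 3 + 1) * (s.reg 3 + 1) * (s.reg 3 + 1) < W := by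
      calc (s.reg 3 + 1) * (s.reg 3 + 1) * (s.reg 3 + 1) =
          s.reg 3 * s.reg 3 * s.reg 3 + 3 * (s.reg 3 * s.reg 3) + 3 * s.reg 3 + 1 := by ring
        _ < W := by omega
    exact eval_le_iff (by omega) (eval_mul (eval_mul e1 e1 e2) e1 e3) h2
  refine (Reaches.loop (T := rootStep.cost) (T' := 0)
    (fun s' => s'.reg 2 = n ∧ s'.reg 3 * s'.reg 3 * s'.reg 3 ≤ n ∧ s'.reg 5 = 0 ∧ s'.mem = s.mem)
    (fun s' => n - s'.reg 3) ?_ n s ⟨h2, by simp [h3], h5, rfl⟩ (Nat.sub_le _ _)).mono ?_ le_rfl le_rfl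
  · rintro s' ⟨h2', h3', h5', hm⟩ htrue
    have hlt := (htest s' h2' h3').mp htrue
    have h4 := (hle _ hlt).1
    refine Reaches.assign (v := s'.reg 3 + 1)
      (eval_add rfl (eval_lit_of_lt (by omega)) (by omega)) ⟨⟨?_, ?_, ?_, hm⟩, ?_⟩
    · simpa using h2'
    · simpa using hlt
    · simpa using h5'
    · simp only [Function.update_self]
      omega
  · rintro s' ⟨⟨h2', h3', h5', hm⟩, hfalse⟩
    refine ⟨h2', ⟨h3', ?_⟩, h5', hm⟩
    by_contra! hle'
    exact (htest s' h2' h3').mpr hle' hfalse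

theorem IsRoot.room {σ : ℕ} (hn : 1 ≤ n) (hσ : IsRoot n σ)
    (hW : (64 + 12 * L + h + θ) * (n * n) < W) :
    Room W n σ (n / σ + 1) (L * (3 * σ)) L h θ := by
  have hb := hσ.blocks_le hn
  have hnn : n ≤ n * n := Nat.le_mul_of_pos_right _ hn
  obtain ⟨h1, h2⟩ := hσ.le
  have hL : L ≤ L * (n * n) := Nat.le_mul_of_pos_right _ (by positivity)
  have hh : h ≤ h * (n * n) := Nat.le_mul_of_pos_right _ (by positivity)
  have hθ : θ ≤ θ * (n * n) := Nat.le_mul_of_pos_right _ (by positivity)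
  have hLσ : L * σ ≤ L * (n * n) := Nat.mul_le_mul_left _ (h2.trans hnn)
  have e : (64 + 12 * L + h + θ) * (n * n) =
      64 * (n * n) + 12 * (L * (n * n)) + h * (n * n) + θ * (n * n) := by ring
  have e1 : 2 * n * n = 2 * (n * n) := by ring
  have e2 : L * (3 * σ) = 3 * (L * σ) := by ring
  rw [e] at hW
  exact ⟨by omega, by omega, hσ.blocks_mul_le, by omega, by omega, by omega, by omega, by omega,
    by omega⟩

def initCost (L : ℕ) : ℕ :=
  (reg 0).size + (rootTest.size + 1) + (((reg 2).div (reg 3)).add (lit 1)).size +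
    ((lit L).mul ((lit 3).mul (reg 3))).size + mainTest.size + 4

theorem reaches_bmmProgram {Tq : ℕ} (hn : 1 ≤ n) (hin : ∀ b i j, input b i j ≤ 1)
    (hrange : ∀ b i j, input b i j ≠ 0 → i < n ∧ j < n)
    (hW : (64 + 12 * L + h + θ) * (n * n) < W)
    (hext : ∀ σ, IsRoot n σ → Detects W ext (L * (3 * σ)) σ L h θ Tq) :
    Reaches W input ext (bmmProgram L h θ) (RamState.init n)
      (fun s' => ∀ i < n, ∀ k < n,
        ((∃ l, input 0 i l ≠ 0 ∧ input 1 l k ≠ 0) → s'.mem (i * n + k) = 1) ∧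
          ((¬ ∃ l, input 0 i l ≠ 0 ∧ input 1 l k ≠ 0) → s'.mem (i * n + k) = 0))
      (initCost L + n * (rootTest.size + 1 + rootStep.cost) + 65 * (n * n) * (mainTest.size + 1 +
        (treatCost L h θ + (Nat.log 2 n + 1) * searchCost L h θ)))
      (65 * (n * n) * ((1 + (Nat.log 2 n + 1)) * (((accessor L h).size + 1) * Tq))) := by
  have hnn : n ≤ n * n := Nat.le_mul_of_pos_right _ hn
  have h64 : 64 * (n * n) ≤ (64 + 12 * L + h + θ) * (n * n) := Nat.mul_le_mul_right _ (by omega)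
  -- The size is copied to register `2` because registers `0` and `1` hold the probed vertices while
  -- the accessor is evaluated.
  refine (Reaches.seq (T₁' := 0) (Reaches.assign (v := n) (by simp [RamExpr.eval, RamState.init])
    (Reaches.seq ((reaches_rootLoop hn (by omega) (by simp) (by simp [RamState.init])
      (by simp [RamState.init])).mono ?_ le_rfl le_rfl)))).mono (fun _ h => h)
    (T₁ := _ + (_ + ((((reg 2).div (reg 3)).add (lit 1)).size + 1 +
      (((lit L).mul ((lit 3).mul (reg 3))).size + 1 + (65 * (n * n) * (mainTest.size + 1 +
        (treatCost L h θ + (Nat.log 2 n + 1) * searchCost L h θ)) + (mainTest.size + 1))))))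
    (T₁' := 0 + (n * 0 + (0 + (0 + _)))) (by unfold initCost; omega)
    (by rw [Nat.mul_zero, Nat.zero_add, Nat.zero_add, Nat.zero_add, Nat.zero_add])
  rintro s₁ ⟨h2, hσ, h5, hmem⟩
  generalize hσ' : s₁.reg 3 = σ at hσ
  have hσ0 := hσ.pos hn
  have hσle := hσ.le
  have hroom := hσ.room hn hW
  have htr := hroom.triple
  have hord := hroom.order
  have hone := hroom.one
  have hdiv : n / σ ≤ n := Nat.div_le_self _ _
  refine Reaches.seq (Reaches.assign (v := n / σ + 1) ?_ (Reaches.seq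
    (Reaches.assign (v := L * (3 * σ)) ?_ ?_)))
  · exact eval_add (eval_div h2 hσ' (by omega)) (eval_lit_of_lt (by omega)) (by omega)
  · exact eval_mul (eval_lit_of_lt hroom.copies) (eval_mul (eval_lit_of_lt (by omega))
      (by simp [RamExpr.eval, hσ']) (by omega)) (by omega)
  have hlt : n < (n / σ + 1) * σ := by
    rw [mul_comm]
    exact Nat.lt_mul_div_succ n hσ0
  have hclog : Nat.clog 2 (σ * σ) ≤ Nat.log 2 n + 1 := by
    refine (Nat.clog_mono_right 2 hσle.1).trans ?_
    exact Nat.clog_le_of_le_pow (Nat.lt_pow_succ_log_self one_lt_two n).le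
  have hcount : (n / σ + 1) * (n / σ + 1) * (n / σ + 1) + n * n ≤ 65 * (n * n) := by
    have := hσ.blocks_le hn
    omega
  refine (reaches_mainLoop hroom hin hrange hσ0 hlt rfl (hext σ hσ) ?_).mono ?_ ?_ ?_
  · refine ⟨?_, ?_, ?_, ?_, ?_, ?_, ?_⟩
    · simpa using h2
    · simpa using hσ'
    · simp
    · simp
    · simp [h5]
    · intro c hc h0
      simp [hmem, RamState.init] at h0
    · intro i j k _ _ hT
      simp [h5] at hT
  · intro s' hrec i hi k hk
    have hc : i * n + k < n * n := by
      calc i * n + k < i * n + n := by omega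
        _ = (i + 1) * n := by ring
        _ ≤ n * n := Nat.mul_le_mul_right _ hi
    have hd : (i * n + k) / n = i := by
      rw [mul_comm, Nat.mul_add_div hn, Nat.div_eq_of_lt hk, add_zero]
    have hm : (i * n + k) % n = k := by rw [mul_comm, Nat.mul_add_mod, Nat.mod_eq_of_lt hk]
    have hsound := hrec.sound _ hc
    rw [hd, hm] at hsound
    refine ⟨?_, fun hex => ?_⟩
    · rintro ⟨l, h0, h1⟩
      refine (hsound (hrec.complete i l k h0 h1 ?_)).1
      have hb : ∀ x < n, x / σ < n / σ + 1 := fun x hx =>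
        Nat.lt_succ_of_le (Nat.div_le_div_right hx.le)
      have b1 := hb i hi
      have b2 := hb l (hrange _ _ _ h0).2
      have b3 := hb k hk
      generalize n / σ + 1 = b at *
      calc (i / σ * b + l / σ) * b + k / σ < (i / σ * b + l / σ) * b + b := by omega
        _ = (i / σ * b + l / σ + 1) * b := by ring
        _ ≤ (i / σ * b + b) * b := Nat.mul_le_mul_right _ (by omega)
        _ = (i / σ + 1) * b * b := by ring
        _ ≤ b * b * b := Nat.mul_le_mul_right _ (Nat.mul_le_mul_right _ b1)
    · by_contra h0
      exact hex (hsound h0).2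
  · gcongr
  · gcongr

end program

/-! ### Detection by an approximation of the trussness -/

theorem exists_lt_wordModulus (M d : ℕ) : ∃ w, ∀ n, 1 ≤ n → M * n ^ d < wordModulus w n := by
  -- The base `2 ^ (Nat.log 2 n + 1)` is at least `2` and at least `n`: `M` factors exceed `M`, and
  -- `d` more cover `n ^ d`.
  refine ⟨M + d, fun n hn => ?_⟩
  unfold wordModulus
  have h1 : n ≤ 2 ^ (Nat.log 2 n + 1) := (Nat.lt_pow_succ_log_self one_lt_two n).le
  have h2 : M < (2 ^ (Nat.log 2 n + 1)) ^ M := by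
    calc M < 2 ^ M := Nat.lt_two_pow_self
      _ ≤ (2 ^ (Nat.log 2 n + 1)) ^ M := Nat.pow_le_pow_left (by
        calc 2 = 2 ^ 1 := rfl
          _ ≤ 2 ^ (Nat.log 2 n + 1) := Nat.pow_le_pow_right (by norm_num) (by omega)) _
  rw [mul_comm (M + d), pow_mul, pow_add]
  exact Nat.mul_lt_mul_of_lt_of_le h2 (Nat.pow_le_pow_left h1 d) (by positivity)

theorem wordModulus_le (k n : ℕ) (hn : 1 ≤ n) : wordModulus k n ≤ (2 * n) ^ k := by
  unfold wordModulus
  rw [mul_comm, pow_mul, pow_succ, mul_comm]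
  exact Nat.pow_le_pow_left (Nat.mul_le_mul_left _ (Nat.pow_log_le_self 2 (by omega))) k

/-- The constants of the reduction separate the trussness of gadgets without and with a triangle. -/
structure Separates (c κ : ℝ) (L h θ : ℕ) : Prop where
  pos : 0 < h
  le : h ≤ L
  dense : 25 * κ ≤ h
  mul_le : c * h ≤ θ
  add_le : h + c ^ 2 / 2 ≤ θ
  lt_mul : θ * c < L
  lt_add : θ + c ^ 2 / 2 < L

/-- The constants are chosen one after the other, each large in terms of its predecessors: `h` for
the density, `θ` above both error ranges around `h`, `L` so that both error ranges around it stay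
above `θ`. -/
theorem exists_separates (c κ : ℝ) (hc : 1 ≤ c) : ∃ L h θ, Separates c κ L h θ := by
  obtain ⟨h, hh⟩ := exists_nat_gt (25 * κ)
  obtain ⟨θ, hθ⟩ := exists_nat_gt (c * ((h + 1 : ℕ) : ℝ) + c ^ 2)
  obtain ⟨L, hL⟩ := exists_nat_gt (θ * c + c ^ 2)
  have h1 : ((h + 1 : ℕ) : ℝ) ≤ c * ((h + 1 : ℕ) : ℝ) := le_mul_of_one_le_left (by positivity) hc
  have h2 : (θ : ℝ) ≤ θ * c := le_mul_of_one_le_right (by positivity) hc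
  have h3 : 0 ≤ c ^ 2 := sq_nonneg c
  refine ⟨L, h + 1, θ, Nat.succ_pos _, ?_, ?_, ?_, ?_, ?_, ?_⟩
  · have : ((h + 1 : ℕ) : ℝ) ≤ L := by linarith
    exact_mod_cast this
  · push_cast; linarith
  · linarith
  · linarith
  · linarith
  · linarith

theorem approx_iff {c κ : ℝ} (hc : 1 ≤ c) {L h θ : ℕ} (hsep : Separates c κ L h θ) {F : ℕ → ℕ → Prop}
    {P σ : ℕ} (hP : P = L * (3 * σ)) (hF : ∀ a b, F a b → a < b ∧ b < 3 * σ) {a b : ℕ} (hb : 0 < b)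
    (happ : ApproxWithin c (trussness (gadget F P L h)) ((a : ℝ) / b)) :
    θ * b < a ↔ ∃ x y z, F x y ∧ F y z ∧ F x z := by
  have hb' : (0 : ℝ) < b := by exact_mod_cast hb
  have hc0 : 0 < c := by linarith
  have hiff : θ * b < a ↔ (θ : ℝ) < a / b := by
    rw [lt_div_iff₀ hb']
    exact_mod_cast Iff.rfl
  rw [hiff]
  constructor
  · intro hlt
    by_contra hfree
    have ht : (trussness (gadget F P L h) : ℝ) ≤ h := by
      exact_mod_cast trussness_gadget_le (fun a b hab => (hF a b hab).1) hfree
    rcases happ with ⟨-, h1⟩ | h1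
    · have := mul_le_mul_of_nonneg_left ht hc0.le
      linarith [hsep.mul_le]
    · linarith [hsep.add_le, (abs_le.mp h1).2]
  · rintro ⟨x, y, z, hxy, hyz, hxz⟩
    have ht : (L : ℝ) ≤ trussness (gadget F P L h) := by
      have hz := (hF _ _ hxz).2
      have : (z + 1) * L ≤ P := by
        rw [hP, mul_comm]
        exact Nat.mul_le_mul_left _ hz
      exact_mod_cast le_trussness_gadget (fun a b hab => (hF a b hab).1) (hsep.pos.trans_le hsep.le)
        this hxy hyz hxz
    rcases happ with ⟨h1, -⟩ | h1
    · refine lt_of_lt_of_le ?_ h1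
      rw [lt_div_iff₀ hc0]
      linarith [hsep.lt_mul]
    · linarith [hsep.lt_add, (abs_le.mp h1).1]

/-- As `h ≤ L ≤ P`, there are at most `5 * P` vertices and `25 * P ^ 2` edges, against at least `h *
P ^ 2` triangles. -/
theorem dense_gadget {c κ : ℝ} (hκ : 0 < κ) {L h θ : ℕ} (hsep : Separates c κ L h θ)
    {F : ℕ → ℕ → Prop} {P : ℕ} (hP : L ≤ P) :
    κ * edgeCount (gadget F P L h) ≤ triangleCount (gadget F P L h) := by
  have h1 : (edgeCount (gadget F P L h) : ℝ) ≤ ((4 * P + h : ℕ) : ℝ) * ((4 * P + h : ℕ) : ℝ) := by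
    exact_mod_cast edgeCount_le _ _
  have h2 : ((P : ℝ) * (P * h)) ≤ triangleCount (gadget F P L h) := by
    exact_mod_cast le_triangleCount_gadget
  have h3 : ((4 * P + h : ℕ) : ℝ) ≤ 5 * P := by
    have := hsep.le
    exact_mod_cast (by omega : 4 * P + h ≤ 5 * P)
  calc κ * edgeCount (gadget F P L h) ≤ κ * ((5 * P) * (5 * P)) := by
        refine mul_le_mul_of_nonneg_left (h1.trans ?_) hκ.le
        exact mul_le_mul h3 h3 (by positivity) (by positivity)
    _ = (25 * κ) * (P * P) := by ring
    _ ≤ h * (P * P) := mul_le_mul_of_nonneg_right hsep.dense (by positivity)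
    _ = P * (P * h) := by ring
    _ ≤ _ := h2

/-! ### Estimates of the running time -/

theorem one_add_log_le {K x : ℝ} (hK : 1 ≤ K) (hx : 1 ≤ x) :
    1 + Real.log (K * x) ≤ (1 + Real.log K) * (1 + Real.log x) := by
  rw [Real.log_mul (by positivity) (by positivity)]
  nlinarith [mul_nonneg (Real.log_nonneg hK) (Real.log_nonneg hx)]

theorem log_pow_le (δ : ℝ) (hδ : 0 < δ) (j : ℕ) :
    ∃ M : ℝ, 0 ≤ M ∧ ∀ x : ℝ, 1 ≤ x → (1 + Real.log x) ^ j ≤ M * x ^ δ := by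
  -- Dividing by `j + 1` ensures `η * j ≤ δ` and also covers `j = 0`.
  set η := δ / (j + 1) with hη
  have hη0 : 0 < η := by positivity
  refine ⟨(1 + 1 / η) ^ j, by positivity, fun x hx => ?_⟩
  have hx0 : 0 ≤ x := by linarith
  have h1 : 1 + Real.log x ≤ (1 + 1 / η) * x ^ η := by
    have h2 := Real.log_le_rpow_div hx0 hη0
    have h3 := Real.one_le_rpow hx hη0.le
    have h4 : (1 + 1 / η) * x ^ η = x ^ η + x ^ η / η := by ring
    linarith
  calc (1 + Real.log x) ^ j ≤ ((1 + 1 / η) * x ^ η) ^ j :=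
        pow_le_pow_left₀ (by linarith [Real.log_nonneg hx]) h1 j
    _ = (1 + 1 / η) ^ j * x ^ (η * j) := by
        rw [mul_pow, ← Real.rpow_natCast (x ^ η), ← Real.rpow_mul hx0]
    _ ≤ (1 + 1 / η) ^ j * x ^ δ := by
        refine mul_le_mul_of_nonneg_left (Real.rpow_le_rpow_of_exponent_le hx ?_) (by positivity)
        rw [hη, div_mul_eq_mul_div, div_le_iff₀ (by positivity)]
        nlinarith

theorem log_two_le (n : ℕ) : ((Nat.log 2 n : ℕ) : ℝ) + 1 ≤ 2 * (1 + Real.log n) := by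
  have h1 := Real.natLog_le_logb n 2
  have h2 : Real.logb 2 n ≤ 2 * Real.log n := by
    rw [Real.logb, div_le_iff₀ (Real.log_pos one_lt_two)]
    have h3 : 0 ≤ Real.log n := Real.log_natCast_nonneg n
    nlinarith [Real.log_two_gt_d9]
  push_cast at h1
  linarith

/-- The time of a call on a graph with `N ≤ K n ^ (1 / 3)` vertices. -/
theorem call_time_le {ε ε' C K : ℝ} (hε : ε' ≤ ε) (hε' : ε' ≤ 1 / 3) (hε0 : 0 < ε') (hK : 1 ≤ K)
    (k : ℕ) {N n σ X : ℕ} (hN : 1 ≤ N) (hn : 1 ≤ n) (hσ : σ * σ * σ ≤ n) (hσn : σ ≤ n)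
    (hNσ : (N : ℝ) ≤ K * σ) (hX : X ≤ N * N * N) :
    C * ((N : ℝ) ^ 2 + (X : ℝ) ^ (1 - ε)) * (1 + Real.log N) ^ k ≤
      |C| * (2 * K ^ 3) * (1 + Real.log K) ^ k * ((n : ℝ) ^ (1 - ε') * (1 + Real.log n) ^ k) := by
  have hn' : (1 : ℝ) ≤ n := by exact_mod_cast hn
  have hN' : (1 : ℝ) ≤ N := by exact_mod_cast hN
  have hK3 : 1 ≤ K ^ 3 := one_le_pow₀ hK
  set Y : ℝ := K ^ 3 * n with hY
  have hY1 : 1 ≤ Y := one_le_mul_of_one_le_of_one_le hK3 hn'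
  have hNY : (N : ℝ) ^ (3 : ℕ) ≤ Y := by
    calc (N : ℝ) ^ 3 ≤ (K * σ) ^ 3 := pow_le_pow_left₀ (by positivity) hNσ 3
      _ = K ^ 3 * ((σ * σ * σ : ℕ) : ℝ) := by push_cast; ring
      _ ≤ K ^ 3 * n := mul_le_mul_of_nonneg_left (by exact_mod_cast hσ) (by positivity)
  -- The reading term equals `(N ^ 3) ^ (2 / 3)`, which is where `ε' ≤ 1 / 3` is needed.
  have h1 : (N : ℝ) ^ 2 ≤ Y ^ (1 - ε') := by
    calc (N : ℝ) ^ 2 = ((N : ℝ) ^ (3 : ℕ)) ^ (2 / 3 : ℝ) := by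
          rw [← Real.rpow_natCast_mul (by positivity)]
          norm_num
      _ ≤ Y ^ (2 / 3 : ℝ) := Real.rpow_le_rpow (by positivity) hNY (by norm_num)
      _ ≤ Y ^ (1 - ε') := Real.rpow_le_rpow_of_exponent_le hY1 (by linarith)
  have h2 : (X : ℝ) ^ (1 - ε) ≤ Y ^ (1 - ε') := by
    -- The exponent `1 - ε` may be zero or negative, so `X = 0` is handled apart; there the power is
    -- at most one.
    rcases Nat.eq_zero_or_pos X with rfl | hX0
    · refine le_trans ?_ (Real.one_le_rpow hY1 (by linarith))
      simpa using Real.zero_rpow_le_one (1 - ε)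
    · have hX1 : (1 : ℝ) ≤ X := by exact_mod_cast hX0
      have hXY : (X : ℝ) ≤ Y := by
        refine le_trans ?_ hNY
        have : (X : ℝ) ≤ ((N * N * N : ℕ) : ℝ) := by exact_mod_cast hX
        refine this.trans (le_of_eq ?_)
        push_cast; ring
      exact (Real.rpow_le_rpow_of_exponent_le hX1 (by linarith)).trans
        (Real.rpow_le_rpow (by positivity) hXY (by linarith))
  have h3 : Y ^ (1 - ε') ≤ K ^ 3 * (n : ℝ) ^ (1 - ε') := by
    rw [hY, Real.mul_rpow (by positivity) (by positivity)]
    refine mul_le_mul_of_nonneg_right ?_ (by positivity)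
    calc (K ^ 3) ^ (1 - ε') ≤ (K ^ 3) ^ (1 : ℝ) :=
          Real.rpow_le_rpow_of_exponent_le hK3 (by linarith)
      _ = K ^ 3 := Real.rpow_one _
  have h4 : 1 + Real.log N ≤ (1 + Real.log K) * (1 + Real.log n) := by
    refine le_trans ?_ (one_add_log_le hK hn')
    have : (N : ℝ) ≤ K * n := hNσ.trans (mul_le_mul_of_nonneg_left (by exact_mod_cast hσn) (by linarith))
    linarith [Real.log_le_log (by linarith) this]
  have h5 : 0 ≤ 1 + Real.log N := by linarith [Real.log_nonneg hN']
  calc C * ((N : ℝ) ^ 2 + (X : ℝ) ^ (1 - ε)) * (1 + Real.log N) ^ k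
      ≤ |C| * ((N : ℝ) ^ 2 + (X : ℝ) ^ (1 - ε)) * (1 + Real.log N) ^ k := by
        gcongr
        exact le_abs_self C
    _ ≤ |C| * (2 * (K ^ 3 * (n : ℝ) ^ (1 - ε'))) * ((1 + Real.log K) * (1 + Real.log n)) ^ k := by
        gcongr
        linarith
    _ = _ := by
        rw [mul_pow]
        ring

/-- The gadget satisfies the promise of `A`. Its order `12 * L * σ + h` is at most `K * σ`, so the
answers of `A` are polynomial in `n` and fit, even multiplied by `θ`, into the words of the caller.
-/
theorem detects_of_fast {c κ ε ε' C : ℝ} {k : ℕ} {A : RamProgram} (hc : 1 ≤ c) (hκ : 0 < κ)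
    (hε : ε' ≤ ε) (hε' : ε' ≤ 1 / 3) (hε0 : 0 < ε')
    (hA : ∀ n : ℕ, 1 ≤ n → ∀ G : SimpleGraph (Fin n),
      (∀ v, ∃ w, G.Adj v w) → κ * edgeCount G ≤ triangleCount G →
      ∃ a b t : ℕ, A.Runs n (adjacencyInput G) a b t ∧ 0 < b ∧
        ApproxWithin c (trussness G) ((a : ℝ) / b) ∧
        (t : ℝ) ≤ C * ((n : ℝ) ^ 2 + ((edgeCount G : ℝ) * arboricity G) ^ (1 - ε))
          * (1 + Real.log n) ^ k)
    {L h θ : ℕ} (hsep : Separates c κ L h θ) {K : ℕ} (hK : K = 12 * L + h) {n σ W : ℕ} (hn : 1 ≤ n)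
    (hσ : IsRoot n σ) (hW : (θ + 1) * (K * n + (2 * (K * n)) ^ A.wordConst) < W) :
    Detects W A.Runs (L * (3 * σ)) σ L h θ
      ⌊|C| * (2 * (K : ℝ) ^ 3) * (1 + Real.log K) ^ k *
        ((n : ℝ) ^ (1 - ε') * (1 + Real.log n) ^ k)⌋₊ := by
  intro F hF
  have hσ0 := hσ.pos hn
  have hL : 0 < L := hsep.pos.trans_le hsep.le
  have hh := hsep.pos
  have hP : L ≤ L * (3 * σ) := Nat.le_mul_of_pos_right _ (by omega)
  have hNK : 4 * (L * (3 * σ)) + h ≤ K * σ := by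
    have h1 : h ≤ h * σ := Nat.le_mul_of_pos_right _ hσ0
    calc 4 * (L * (3 * σ)) + h ≤ 4 * (L * (3 * σ)) + h * σ := by omega
      _ = K * σ := by rw [hK]; ring
  have hNn : 4 * (L * (3 * σ)) + h ≤ K * n := hNK.trans (Nat.mul_le_mul_left _ hσ.le.2)
  have hN : 1 ≤ 4 * (L * (3 * σ)) + h := by omega
  obtain ⟨a, b, t, hrun, hb, happ, ht⟩ := hA _ hN (gadget F (L * (3 * σ)) L h)
    (gadget_exists_adj (by omega)) (dense_gadget hκ hsep hP)
  have hiff := approx_iff hc hsep rfl hF hb happ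
  have hword : 4 * (L * (3 * σ)) + h + wordModulus A.wordConst (4 * (L * (3 * σ)) + h) ≤
      K * n + (2 * (K * n)) ^ A.wordConst :=
    Nat.add_le_add hNn ((wordModulus_le _ _ hN).trans
      (Nat.pow_le_pow_left (Nat.mul_le_mul_left _ hNn) _))
  obtain ⟨ha', hb'⟩ := hrun.le
  have hbig : ∀ x, x ≤ K * n + (2 * (K * n)) ^ A.wordConst → x < W ∧ θ * x < W := by
    intro x hx
    rw [Nat.add_mul, one_mul] at hW
    have := Nat.mul_le_mul_left θ hx
    exact ⟨by omega, by omega⟩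
  refine ⟨a, b, t, hrun, (hbig a (ha'.trans hword)).1, (hbig b (hb'.trans hword)).1,
    (hbig b (hb'.trans hword)).2, hiff, Nat.le_floor (ht.trans ?_)⟩
  have := call_time_le (C := C) (K := K) hε hε' hε0 (by exact_mod_cast (by omega : 1 ≤ K)) k hN hn
    hσ.1 hσ.le.2 (by exact_mod_cast hNK)
    (X := edgeCount (gadget F (L * (3 * σ)) L h) * arboricity (gadget F (L * (3 * σ)) L h))
    (Nat.mul_le_mul (edgeCount_le _ _) (arboricity_le _ _))
  simpa only [Nat.cast_mul] using this

theorem matrixInput_le {n : ℕ} (X Y : Matrix (Fin n) (Fin n) Bool) (b i j : ℕ) :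
    matrixInput X Y b i j ≤ 1 := by
  unfold matrixInput
  split_ifs <;> simp

theorem matrixInput_ne_zero {n : ℕ} (X Y : Matrix (Fin n) (Fin n) Bool) (b i j : ℕ) :
    matrixInput X Y b i j ≠ 0 ↔
      ∃ (hi : i < n) (hj : j < n), (if b = 0 then X else Y) ⟨i, hi⟩ ⟨j, hj⟩ = true := by
  unfold matrixInput
  rw [Ne, ite_eq_right_iff]
  simp only [one_ne_zero, imp_false, not_not]

theorem own_time_le (a₀ a₁ a₂ a₃ : ℕ) : ∃ C : ℝ, 0 ≤ C ∧ ∀ n : ℕ, 1 ≤ n →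
    ((a₀ + n * a₁ + 65 * (n * n) * (a₂ + (Nat.log 2 n + 1) * a₃) : ℕ) : ℝ) ≤
      C * (n : ℝ) ^ 2 * (1 + Real.log n) := by
  refine ⟨a₀ + a₁ + 65 * a₂ + 130 * a₃, by positivity, fun n hn => ?_⟩
  have hn' : (1 : ℝ) ≤ n := by exact_mod_cast hn
  have hl := log_two_le n
  have hl0 : 1 ≤ 1 + Real.log n := by linarith [Real.log_nonneg hn']
  generalize 1 + Real.log (n : ℝ) = l at *
  have hnn : (n : ℝ) ≤ (n : ℝ) ^ 2 := by nlinarith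
  have h1 : (1 : ℝ) ≤ (n : ℝ) ^ 2 := hn'.trans hnn
  have e0 : (a₀ : ℝ) ≤ a₀ * ((n : ℝ) ^ 2 * l) :=
    le_mul_of_one_le_right (by positivity) (one_le_mul_of_one_le_of_one_le h1 hl0)
  have e1 : (n : ℝ) * a₁ ≤ a₁ * ((n : ℝ) ^ 2 * l) := by
    rw [mul_comm]
    exact mul_le_mul_of_nonneg_left (hnn.trans (le_mul_of_one_le_right (by positivity) hl0))
      (by positivity)
  have e2 : 65 * ((n : ℝ) * n) * a₂ ≤ 65 * a₂ * ((n : ℝ) ^ 2 * l) := by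
    calc 65 * ((n : ℝ) * n) * a₂ = 65 * a₂ * ((n : ℝ) ^ 2) := by ring
      _ ≤ _ := mul_le_mul_of_nonneg_left (le_mul_of_one_le_right (by positivity) hl0) (by positivity)
  have e3 : 65 * ((n : ℝ) * n) * (((Nat.log 2 n : ℕ) : ℝ) + 1) * a₃ ≤
      130 * a₃ * ((n : ℝ) ^ 2 * l) := by
    calc 65 * ((n : ℝ) * n) * (((Nat.log 2 n : ℕ) : ℝ) + 1) * a₃
        ≤ 65 * ((n : ℝ) * n) * (2 * l) * a₃ := by gcongr
      _ = _ := by ring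
  push_cast
  linarith

theorem sq_mul_log_le {δ : ℝ} (hδ : δ ≤ 1 / 2) : ∃ M : ℝ, 0 ≤ M ∧ ∀ n : ℕ, 1 ≤ n →
    (n : ℝ) ^ 2 * (1 + Real.log n) ≤ M * (n : ℝ) ^ (3 - δ) := by
  obtain ⟨M, hM, hlog⟩ := log_pow_le (1 / 2) (by norm_num) 1
  refine ⟨M, hM, fun n hn => ?_⟩
  have hn' : (1 : ℝ) ≤ n := by exact_mod_cast hn
  have h2 := hlog n hn'
  rw [pow_one] at h2
  calc (n : ℝ) ^ 2 * (1 + Real.log n) ≤ (n : ℝ) ^ 2 * (M * (n : ℝ) ^ (1 / 2 : ℝ)) :=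
        mul_le_mul_of_nonneg_left h2 (by positivity)
    _ = M * (n : ℝ) ^ (2 + 1 / 2 : ℝ) := by
        rw [Real.rpow_add (by linarith), Real.rpow_two]
        ring
    _ ≤ M * (n : ℝ) ^ (3 - δ) :=
        mul_le_mul_of_nonneg_left (Real.rpow_le_rpow_of_exponent_le hn' (by linarith)) hM

theorem calls_time_le (a k : ℕ) {D ε : ℝ} (hD : 0 ≤ D) (hε : 0 < ε) :
    ∃ C : ℝ, 0 ≤ C ∧ ∀ n : ℕ, 1 ≤ n →
      ((65 * (n * n) * ((1 + (Nat.log 2 n + 1)) *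
        (a * ⌊D * ((n : ℝ) ^ (1 - ε) * (1 + Real.log n) ^ k)⌋₊)) : ℕ) : ℝ) ≤
        C * (n : ℝ) ^ (3 - ε / 2) := by
  -- Half of the saving `n ^ ε` absorbs all logarithms: `k` from the calls and one from the binary
  -- search.
  obtain ⟨M, hM, hlog⟩ := log_pow_le (ε / 2) (by positivity) (k + 1)
  refine ⟨65 * 3 * a * D * M, by positivity, fun n hn => ?_⟩
  have hn' : (1 : ℝ) ≤ n := by exact_mod_cast hn
  have hl0 : 0 ≤ 1 + Real.log n := by linarith [Real.log_nonneg hn']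
  have hfl := Nat.floor_le (a := D * ((n : ℝ) ^ (1 - ε) * (1 + Real.log n) ^ k)) (by positivity)
  have h2 : 1 + (((Nat.log 2 n : ℕ) : ℝ) + 1) ≤ 3 * (1 + Real.log n) := by
    linarith [log_two_le n, Real.log_nonneg hn']
  push_cast
  calc 65 * ((n : ℝ) * n) * ((1 + (((Nat.log 2 n : ℕ) : ℝ) + 1)) * (a *
        (⌊D * ((n : ℝ) ^ (1 - ε) * (1 + Real.log n) ^ k)⌋₊ : ℝ)))
      ≤ 65 * ((n : ℝ) * n) * ((3 * (1 + Real.log n)) * (a *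
        (D * ((n : ℝ) ^ (1 - ε) * (1 + Real.log n) ^ k)))) := by gcongr
    _ = 65 * 3 * a * D * ((n : ℝ) ^ 2 * (n : ℝ) ^ (1 - ε)) * (1 + Real.log n) ^ (k + 1) := by ring
    _ ≤ 65 * 3 * a * D * ((n : ℝ) ^ 2 * (n : ℝ) ^ (1 - ε)) * (M * (n : ℝ) ^ (ε / 2)) :=
        mul_le_mul_of_nonneg_left (hlog n hn') (by positivity)
    _ = 65 * 3 * a * D * M * ((n : ℝ) ^ (2 : ℝ) * (n : ℝ) ^ (1 - ε) * (n : ℝ) ^ (ε / 2)) := by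
        rw [Real.rpow_two]
        ring
    _ = 65 * 3 * a * D * M * (n : ℝ) ^ (3 - ε / 2) := by
        rw [← Real.rpow_add (by linarith), ← Real.rpow_add (by linarith)]
        congr 2
        ring

theorem mainTheorem2 (c κ : ℝ) (hc : 1 ≤ c) (hκ : 0 < κ) :
    ∃ R : RamCmd, ∀ A : RamProgram, FastTrussnessApprox c κ A → TrulySubcubicBMM R A := by
  obtain ⟨L, h, θ, hsep⟩ := exists_separates c κ hc
  refine ⟨bmmProgram L h θ, fun A hA => ?_⟩
  obtain ⟨ε, hε, C, k, hA⟩ := hA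
  obtain ⟨ε', hε0, hεle, hεε⟩ : ∃ ε' : ℝ, 0 < ε' ∧ ε' ≤ 1 / 3 ∧ ε' ≤ ε :=
    ⟨min ε (1 / 3), lt_min hε (by norm_num), min_le_right _ _, min_le_left _ _⟩
  obtain ⟨K, hK⟩ : ∃ K, K = 12 * L + h := ⟨_, rfl⟩
  have hK1 : (1 : ℝ) ≤ K := by
    have := hsep.pos
    exact_mod_cast (by omega : 1 ≤ K)
  -- The code is fixed by `L`, `h`, `θ` alone; only the word length depends on `A`, through the size
  -- of its answers.
  obtain ⟨w, hw⟩ := exists_lt_wordModulus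
    ((64 + 12 * L + h + θ) + (θ + 1) * (K + (2 * K) ^ A.wordConst)) (2 + A.wordConst)
  obtain ⟨C₁, hC₁, hown⟩ := own_time_le (initCost L) (rootTest.size + 1 + rootStep.cost)
    (mainTest.size + 1 + treatCost L h θ) (searchCost L h θ)
  obtain ⟨M, hM, hsq⟩ := sq_mul_log_le (δ := ε' / 2) (by linarith)
  have hD0 : 0 ≤ |C| * (2 * (K : ℝ) ^ 3) * (1 + Real.log K) ^ k := by
    have := Real.log_nonneg hK1
    positivity
  have hdetect := fun (n σ : ℕ) => detects_of_fast (n := n) (σ := σ) (W := wordModulus w n)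
    hc hκ hεε hεle hε0 hA hsep hK
  generalize |C| * (2 * (K : ℝ) ^ 3) * (1 + Real.log K) ^ k = D at hD0 hdetect
  obtain ⟨C₂, hC₂, hcalls⟩ := calls_time_le ((accessor L h).size + 1) k hD0 hε0
  refine ⟨w, ε' / 2, by positivity, C₁ + (C₁ * M + C₂), 1, fun n hn X Y => ?_⟩
  have hW := hw n hn
  rw [Nat.add_mul] at hW
  have hnn : n * n ≤ n ^ (2 + A.wordConst) := by
    rw [← sq]
    exact Nat.pow_le_pow_right hn (Nat.le_add_right _ _)
  have hW₁ : (64 + 12 * L + h + θ) * (n * n) < wordModulus w n :=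
    ((Nat.mul_le_mul_left _ hnn).trans (Nat.le_add_right _ _)).trans_lt hW
  have hW₂ : (θ + 1) * (K * n + (2 * (K * n)) ^ A.wordConst) < wordModulus w n := by
    refine (le_trans ?_ (Nat.le_add_left _ _)).trans_lt hW
    have h1 : n ≤ n ^ (2 + A.wordConst) := (Nat.le_mul_of_pos_right n hn).trans hnn
    have h2 : n ^ A.wordConst ≤ n ^ (2 + A.wordConst) := Nat.pow_le_pow_right hn (Nat.le_add_left _ _)
    calc (θ + 1) * (K * n + (2 * (K * n)) ^ A.wordConst)
        = (θ + 1) * (K * n + (2 * K) ^ A.wordConst * n ^ A.wordConst) := by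
          rw [← mul_assoc 2 K n, mul_pow]
      _ ≤ (θ + 1) * (K * n ^ (2 + A.wordConst) + (2 * K) ^ A.wordConst * n ^ (2 + A.wordConst)) :=
          Nat.mul_le_mul_left _ (Nat.add_le_add (Nat.mul_le_mul_left _ h1) (Nat.mul_le_mul_left _ h2))
      _ = _ := by ring
  obtain ⟨s, t, t', hrun, hres, ht, ht'⟩ := reaches_bmmProgram (input := matrixInput X Y)
    (ext := A.Runs) hn (matrixInput_le X Y)
    (fun b i j hb => by
      obtain ⟨hi, hj, -⟩ := (matrixInput_ne_zero X Y b i j).mp hb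
      exact ⟨hi, hj⟩) hW₁ (fun σ hσ => hdetect n σ hn hσ hW₂)
  have hT : (t : ℝ) ≤ C₁ * ((n : ℝ) ^ 2 * (1 + Real.log n)) := by
    rw [← mul_assoc]
    refine le_trans ?_ (hown n hn)
    rw [add_assoc (mainTest.size + 1)]
    exact Nat.cast_le.mpr ht
  have hT' : (t' : ℝ) ≤ C₂ * (n : ℝ) ^ (3 - ε' / 2) := (Nat.cast_le.mpr ht').trans (hcalls n hn)
  have hlog := Real.log_natCast_nonneg n
  refine ⟨s, t, t', hrun, fun i j => ?_, ?_, ?_⟩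
  · have hiff : (∃ l, matrixInput X Y 0 i l ≠ 0 ∧ matrixInput X Y 1 l j ≠ 0) ↔
        ∃ l, X i l = true ∧ Y l j = true := by
      simp only [matrixInput_ne_zero]
      constructor
      · rintro ⟨l, ⟨_, hl, h0⟩, ⟨_, _, h1⟩⟩
        exact ⟨⟨l, hl⟩, h0, h1⟩
      · rintro ⟨l, h0, h1⟩
        exact ⟨l, ⟨i.2, l.2, h0⟩, ⟨l.2, j.2, h1⟩⟩
    have := hres i i.2 j j.2
    rw [hiff] at this
    split_ifs with hex
    · exact this.1 hex
    · exact this.2 hex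
  · rw [pow_one, mul_assoc]
    exact hT.trans (mul_le_mul_of_nonneg_right (le_add_of_nonneg_right (by positivity))
      (by positivity))
  · have h1 := hT.trans (mul_le_mul_of_nonneg_left (hsq n hn) hC₁)
    have h3 : 0 ≤ C₁ * (n : ℝ) ^ (3 - ε' / 2) := by positivity
    linarith
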